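/- Consider preemptive scheduling on a single machine of unit speed. There are $n$ jobs, available at time $0$, with unknown processing times $p_1,\dots,p_n>0$. A schedule is described by the elapsed times $e_j(t)$, the amount of processing that job $j$ has received until time $t$; here $e_j(0)=0$, each $e_j$ is non-decreasing and at most $p_j$, and $\sum_j (e_j(t)-e_j(s))\le t-s$ for $s\le t$ (so the machine may be shared between jobs). The completion time $C_j$ is the earliest $t$ with $e_j(t)\ge p_j$. The cost of a schedule is $\sum_j C_j$, and $\mathrm{OPT}$ is the least cost of a schedule when the processing times are known. Let $\alpha\in[0,1]$ be known. Each job emits a signal exactly when an $\alpha$ fraction of it has been processed: at time $t$ the scheduler sees the displayed progress $\varphi(e_j(t)/p_j)$ of every job $j$, where $\varphi(x)=\alpha\cdot\mathbb 1(\alpha\le x<1)+\mathbb 1(x=1)$. An online algorithm (for each $n$) learns nothing else about the processing times: its schedules on two instances coincide for as long as the displayed progress does. A randomized online algorithm is a random choice of a deterministic one. The competitive ratio of an algorithm is the supremum, over all $n\ge 1$ and all instances with $n$ jobs, of its (expected) cost divided by $\mathrm{OPT}$. Consider the rule that runs Round-Robin over all unfinished jobs (they share the machine equally) and, whenever a job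 emits its signal, runs this job alone until completion; jobs that emit at the same time are served one after the other. 1. If $\alpha\in(0,1]$, the rule can be carried out by a deterministic online algorithm, and every deterministic online algorithm that follows it (whatever the order in which it serves jobs that emit at the same time) has competitive ratio exactly $1+\alpha$. 2. If $\alpha=0$ (all signals are emitted at time $0$; the clairvoyant limit), the rule, when it serves the jobs in an order of non-decreasing processing times, yields for every instance a schedule, and every such schedule has cost $\mathrm{OPT}=(1+\alpha)\mathrm{OPT}$. 3. For every $\alpha\in[0,1]$, every randomized online algorithm has competitive ratio at least $1+\alpha$. -/

import Mathlib

open MeasureTheory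
open scoped NNReal ENNReal

universe u

/-- An instance with `n` jobs, all released at time `0`: their (positive) processing times. -/
structure JobInstance (n : ℕ) where
  size : Fin n → ℝ
  size_pos : ∀ j, 0 < size j

/-- The progress bar of granularity one: displayed progress when the actual progress is `x`, for a
signal of value `α` that is emitted when the actual progress reaches `β`. -/
noncomputable def progressBar (α β x : ℝ) : ℝ :=
  α * (if β ≤ x ∧ x < 1 then 1 else 0) + (if x = 1 then 1 else 0)

/-- A preemptive schedule on one machine of unit speed, given by the processing `elapsed t j` that
job `j` has received until time `t`. The machine may be shared between jobs, and may idle. -/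
structure Schedule {n : ℕ} (J : JobInstance n) where
  elapsed : ℝ≥0 → Fin n → ℝ
  elapsed_zero : ∀ j, elapsed 0 j = 0
  mono : ∀ j s t, s ≤ t → elapsed s j ≤ elapsed t j
  capacity : ∀ s t : ℝ≥0, s ≤ t → ∑ j, (elapsed t j - elapsed s j) ≤ (t : ℝ) - (s : ℝ)
  le_size : ∀ t j, elapsed t j ≤ J.size j

namespace Schedule

variable {n : ℕ} {J : JobInstance n}

/-- The earliest time at which job `j` is fully processed (`∞` if there is no such time). -/
noncomputable def completionTime (S : Schedule J) (j : Fin n) : ℝ≥0∞ :=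
  ⨅ (t : ℝ≥0) (_ : J.size j ≤ S.elapsed t j), (t : ℝ≥0∞)

/-- The objective: the sum of the completion times. -/
noncomputable def totalCompletionTime (S : Schedule J) : ℝ≥0∞ :=
  ∑ j, S.completionTime j

/-- The displayed progress of job `j` at time `t` when all signals are accurate. -/
noncomputable def displayed (S : Schedule J) (α : ℝ) (t : ℝ≥0) (j : Fin n) : ℝ :=
  progressBar α α (S.elapsed t j / J.size j)

/-- The jobs that are not completed at time `t`. -/
noncomputable def alive (S : Schedule J) (t : ℝ≥0) : Finset (Fin n) :=
  Finset.univ.filter (fun j => S.elapsed t j < J.size j)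

/-- Job `j` has emitted its accurate signal by time `t`. -/
def Emitted (S : Schedule J) (α : ℝ) (t : ℝ≥0) (j : Fin n) : Prop :=
  α * J.size j ≤ S.elapsed t j

/-- `S` is a schedule produced by the rule "Round-Robin over all unfinished jobs; whenever a job
emits its signal, it is run alone until completion". Jobs that emit at the same time are served one
after the other, in any order. -/
structure IsSignalRoundRobin (S : Schedule J) (α : ℝ) : Prop where
  /-- As long as no unfinished job has emitted its signal and no job completes, the unfinished
  jobs equally share the machine. -/
  roundRobin : ∀ t u : ℝ≥0, t ≤ u →
    (∀ s, t ≤ s → s < u → S.alive s = S.alive t ∧ ∀ j ∈ S.alive s, ¬ S.Emitted α s j) →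
    ∀ j ∈ S.alive t,
      S.elapsed u j = S.elapsed t j + ((u : ℝ) - (t : ℝ)) / ((S.alive t).card : ℝ)
  /-- Whenever there are unfinished jobs that have emitted their signal, one of them is run alone
  until its completion. -/
  preferential : ∀ t : ℝ≥0, (∃ j ∈ S.alive t, S.Emitted α t j) →
    ∃ i ∈ S.alive t, S.Emitted α t i ∧
      ∀ s : ℝ≥0, S.elapsed t i + (s : ℝ) ≤ J.size i →
        S.elapsed (t + s) i = S.elapsed t i + (s : ℝ) ∧
        ∀ k, k ≠ i → S.elapsed (t + s) k = S.elapsed t k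

/-- Shorter jobs are completed no later than longer ones. -/
def ShortestFirst (S : Schedule J) : Prop :=
  ∀ i j, J.size i < J.size j → S.completionTime i ≤ S.completionTime j

end Schedule

/-- The optimal (offline) objective value. -/
noncomputable def JobInstance.opt {n : ℕ} (J : JobInstance n) : ℝ≥0∞ :=
  ⨅ S : Schedule J, S.totalCompletionTime

/-- A deterministic online algorithm for `n` jobs with accurate signals at `α`. All it learns about
the processing times is the displayed progress of the jobs over time: its decisions coincide on two
instances for as long as the displayed progress does. -/
structure OnlineAlgorithm (α : ℝ) (n : ℕ) where
  run : (J : JobInstance n) → Schedule J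
  nonanticipating : ∀ (J J' : JobInstance n) (t : ℝ≥0),
    (∀ s, s < t → ∀ j, (run J).displayed α s j = (run J').displayed α s j) →
    ∀ j, (run J).elapsed t j = (run J').elapsed t j

/-- A randomized online algorithm: a random deterministic online algorithm. -/
structure RandomizedAlgorithm (α : ℝ) (n : ℕ) where
  Ω : Type u
  mΩ : MeasurableSpace Ω
  μ : Measure Ω
  isProb : IsProbabilityMeasure μ
  alg : Ω → OnlineAlgorithm α n
  measurable_elapsed : ∀ (J : JobInstance n) (t : ℝ≥0) (j : Fin n),
    Measurable (fun ω => ((alg ω).run J).elapsed t j)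

/-- A deterministic algorithm, seen as a randomized one. -/
noncomputable def OnlineAlgorithm.toRandomized {α : ℝ} {n : ℕ} (A : OnlineAlgorithm α n) :
    RandomizedAlgorithm.{0} α n where
  Ω := Unit
  mΩ := inferInstance
  μ := Measure.dirac ()
  isProb := inferInstance
  alg := fun _ => A
  measurable_elapsed := fun _ _ _ => measurable_const

/-- The expected total completion time on an instance. -/
noncomputable def RandomizedAlgorithm.expectedCost {α : ℝ} {n : ℕ} (B : RandomizedAlgorithm α n)
    (J : JobInstance n) : ℝ≥0∞ :=
  @lintegral B.Ω B.mΩ B.μ (fun ω => ((B.alg ω).run J).totalCompletionTime)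

/-- The competitive ratio: the worst ratio of expected cost and optimum over all instances with any
number of jobs (the empty instance contributes `0 / 0 = 0`). -/
noncomputable def competitiveRatio {α : ℝ} (B : ∀ n : ℕ, RandomizedAlgorithm α n) : ℝ≥0∞ :=
  ⨆ (n : ℕ) (J : JobInstance n), (B n).expectedCost J / J.opt

/-! Both bounds come from counting costs by pairs. Up to time `C j` the machine has processed at
most `C j`, so twice the cost is at least the sum over all ordered pairs `(i, j)` of `e_i(C_j) +
e_j(C_i)`, the delay that two jobs cause each other, with equality if the machine never idles while
work remains. For `i ≠ j` this delay is at least the smaller size, and for `i = j` it is twice the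
size. This gives the lower bound `sptCost` on the optimum.

Under the rule, two jobs receive equal processing until the first of them, say `j`, is about to run
alone; both then have received `α * p_j`, and `j` is run to completion. The mutual delay is exactly
`(1 + α) * p_j`. For `α > 0` the job `j` is the shorter one, and for `α = 0` this is ensured by
serving short jobs first. Summing gives cost at most `(1 + α) * sptCost`
(`IsSignalRoundRobin.totalCompletionTime_le`). The case `α = 0` also shows that `sptCost` is the
optimum.

The lower bound uses Yao's principle with independent, truncated geometric sizes. If `i` is
completed first, the delay is `p_i + e_j(C_i)`, which is at least `min + α * max` minus the
processing that `j` still needs until its signal. An algorithm learns nothing about `p_j` before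
that signal, so by memorylessness the expected missing amount is at most `α / (1 - q)` times the
probability that the signal is missing (`sum_weight_mul_residual_le`). The signal of `j` cannot be
missing at `C_i` while that of `i` is missing at `C_j`, so a pair loses at most `α / (1 - q)` in
total. Removing the truncation and letting `q` tend to `1`, the delay of a pair, scaled by `1 - q`,
is at least `(1 + α) / 2` in the limit, against `1 / 2` for the optimum. Many jobs make the diagonal
terms negligible. -/

namespace Schedule

variable {n : ℕ} {J : JobInstance n}

/-! ### Completion times, mutual delays and the lower bound on the optimum -/

theorem elapsed_nonneg (S : Schedule J) (t : ℝ≥0) (j : Fin n) : 0 ≤ S.elapsed t j := by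
  rw [← S.elapsed_zero j]
  exact S.mono j 0 t zero_le

theorem elapsed_sub_le (S : Schedule J) (j : Fin n) {s t : ℝ≥0} (h : s ≤ t) :
    S.elapsed t j - S.elapsed s j ≤ (t : ℝ) - s :=
  (Finset.single_le_sum (f := fun j => S.elapsed t j - S.elapsed s j)
    (fun k _ => sub_nonneg.2 (S.mono k s t h)) (Finset.mem_univ j)).trans (S.capacity s t h)

theorem continuous_elapsed (S : Schedule J) (j : Fin n) :
    Continuous fun t => S.elapsed t j := by
  have key : ∀ s t : ℝ≥0, s ≤ t → |S.elapsed s j - S.elapsed t j| ≤ |(s : ℝ) - t| := by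
    intro s t h
    have h1 := S.elapsed_sub_le j h
    have h2 := S.mono j s t h
    have h3 : (s : ℝ) ≤ t := h
    rw [abs_sub_comm, abs_sub_comm (s : ℝ), abs_of_nonneg (by linarith),
      abs_of_nonneg (by linarith)]
    exact h1
  refine LipschitzWith.continuous (K := 1) (LipschitzWith.of_dist_le_mul fun s t => ?_)
  rw [NNReal.dist_eq, Real.dist_eq, NNReal.coe_one, one_mul]
  rcases le_total s t with h | h
  · exact key s t h
  · rw [abs_sub_comm, abs_sub_comm (s : ℝ)]
    exact key t s h

theorem sum_elapsed_le (S : Schedule J) (t : ℝ≥0) : ∑ j, S.elapsed t j ≤ t := by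
  have := S.capacity 0 t zero_le
  simpa [S.elapsed_zero] using this

theorem mem_alive (S : Schedule J) (t : ℝ≥0) (j : Fin n) :
    j ∈ S.alive t ↔ S.elapsed t j < J.size j := by
  simp [alive]

theorem elapsed_eq_of_le (S : Schedule J) {s t : ℝ≥0} {j : Fin n} (h : s ≤ t)
    (hs : J.size j ≤ S.elapsed s j) : S.elapsed t j = J.size j :=
  le_antisymm (S.le_size t j) (hs.trans (S.mono j s t h))

/-- Job `j` is completed exactly at time `t`. -/
def CompletesAt (S : Schedule J) (j : Fin n) (t : ℝ≥0) : Prop :=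
  S.elapsed t j = J.size j ∧ ∀ s < t, S.elapsed s j < J.size j

theorem CompletesAt.completionTime_eq {S : Schedule J} {j : Fin n} {t : ℝ≥0}
    (h : S.CompletesAt j t) : S.completionTime j = t := by
  refine le_antisymm (iInf₂_le t h.1.ge) (le_iInf₂ fun s hs => ?_)
  by_contra! hlt
  exact absurd hs (not_le.2 (h.2 s (by exact_mod_cast hlt)))

theorem exists_completesAt (S : Schedule J) {j : Fin n} {t : ℝ≥0}
    (h : J.size j ≤ S.elapsed t j) : ∃ s ≤ t, S.CompletesAt j s := by
  have hcl : IsClosed {s | J.size j ≤ S.elapsed s j} :=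
    isClosed_le continuous_const (S.continuous_elapsed j)
  have hmem := hcl.csInf_mem ⟨t, h⟩ (OrderBot.bddBelow _)
  have hle : ∀ s ∈ {s | J.size j ≤ S.elapsed s j}, sInf {s | J.size j ≤ S.elapsed s j} ≤ s :=
    fun s hs => csInf_le (OrderBot.bddBelow _) hs
  refine ⟨_, hle t h, le_antisymm (S.le_size _ j) hmem, fun s hs => ?_⟩
  by_contra! hs'
  exact absurd (hle s hs') (not_le.2 hs)

theorem exists_completesAt_of_ne_top (S : Schedule J) {j : Fin n}
    (h : S.completionTime j ≠ ⊤) : ∃ s, S.CompletesAt j s := by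
  by_contra! hno
  refine h (iInf₂_eq_top.2 fun t ht => ?_)
  obtain ⟨s, -, hs⟩ := S.exists_completesAt ht
  exact absurd hs (hno s)

theorem exists_forall_completesAt (S : Schedule J) (h : S.totalCompletionTime ≠ ⊤) :
    ∃ C : Fin n → ℝ≥0, ∀ j, S.CompletesAt j (C j) := by
  have : ∀ j, S.completionTime j ≠ ⊤ := fun j =>
    ENNReal.sum_ne_top.1 h j (Finset.mem_univ j)
  choose C hC using fun j => S.exists_completesAt_of_ne_top (this j)
  exact ⟨C, hC⟩

theorem totalCompletionTime_eq (S : Schedule J) {C : Fin n → ℝ≥0}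
    (hC : ∀ j, S.CompletesAt j (C j)) :
    S.totalCompletionTime = ENNReal.ofReal (∑ j, (C j : ℝ)) := by
  rw [ENNReal.ofReal_sum_of_nonneg fun j _ => (C j).coe_nonneg]
  exact Finset.sum_congr rfl fun j _ => by
    rw [(hC j).completionTime_eq, ENNReal.ofReal_coe_nnreal]

theorem sum_sum_elapsed_le (S : Schedule J) (C : Fin n → ℝ≥0) :
    ∑ i, ∑ j, (S.elapsed (C j) i + S.elapsed (C i) j) ≤ 2 * ∑ j, (C j : ℝ) := by
  have h : ∑ j, ∑ i, S.elapsed (C j) i ≤ ∑ j, (C j : ℝ) :=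
    Finset.sum_le_sum fun j _ => S.sum_elapsed_le (C j)
  simp only [Finset.sum_add_distrib]
  rw [Finset.sum_comm]
  linarith

theorem CompletesAt.elapsed_eq {S : Schedule J} {j : Fin n} {s t : ℝ≥0}
    (h : S.CompletesAt j s) (hst : s ≤ t) : S.elapsed t j = J.size j :=
  S.elapsed_eq_of_le hst h.1.ge

theorem CompletesAt.le_of_size_le {S : Schedule J} {j : Fin n} {s t : ℝ≥0}
    (h : S.CompletesAt j s) (hst : J.size j ≤ S.elapsed t j) : s ≤ t := by
  by_contra! hlt
  exact absurd hst (not_le.2 (h.2 t hlt))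

/-- At the later of the two completion times the other job is already finished, so it contributes
its full size. On the diagonal both terms are the size itself, whence the extra summand. -/
theorem min_size_le (S : Schedule J) {C : Fin n → ℝ≥0} (hC : ∀ j, S.CompletesAt j (C j))
    (i j : Fin n) : min (J.size i) (J.size j) + (if i = j then J.size i else 0) ≤
      S.elapsed (C j) i + S.elapsed (C i) j := by
  split_ifs with hij
  · subst hij
    rw [(hC i).1, min_self]
  · rcases le_total (C i) (C j) with h | h
    · rw [(hC i).elapsed_eq h]
      have := S.elapsed_nonneg (C i) j
      have := min_le_left (J.size i) (J.size j)
      linarith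
    · rw [(hC j).elapsed_eq h]
      have := S.elapsed_nonneg (C j) i
      have := min_le_right (J.size i) (J.size j)
      linarith

end Schedule

/-- The cost of processing the jobs one after the other, shortest jobs first. -/
noncomputable def JobInstance.sptCost {n : ℕ} (J : JobInstance n) : ℝ :=
  (∑ i, J.size i + ∑ i, ∑ j, min (J.size i) (J.size j)) / 2

theorem Schedule.sptCost_le {n : ℕ} {J : JobInstance n} (S : Schedule J) :
    ENNReal.ofReal J.sptCost ≤ S.totalCompletionTime := by
  by_cases h : S.totalCompletionTime = ⊤
  · simp [h]
  obtain ⟨C, hC⟩ := S.exists_forall_completesAt h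
  rw [S.totalCompletionTime_eq hC]
  refine ENNReal.ofReal_le_ofReal ?_
  have h1 := S.sum_sum_elapsed_le C
  have h2 : ∑ i, ∑ j, (min (J.size i) (J.size j) + (if i = j then J.size i else 0)) ≤
      ∑ i, ∑ j, (S.elapsed (C j) i + S.elapsed (C i) j) :=
    Finset.sum_le_sum fun i _ => Finset.sum_le_sum fun j _ => S.min_size_le hC i j
  simp only [Finset.sum_add_distrib (s := Finset.univ), Finset.sum_ite_eq, Finset.mem_univ,
    if_true] at h2 h1
  simp only [JobInstance.sptCost]
  linarith

theorem JobInstance.sptCost_le_opt {n : ℕ} (J : JobInstance n) :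
    ENNReal.ofReal J.sptCost ≤ J.opt :=
  le_iInf fun S => S.sptCost_le

theorem JobInstance.opt_le {n : ℕ} (J : JobInstance n) (S : Schedule J) :
    J.opt ≤ S.totalCompletionTime :=
  iInf_le _ S

theorem JobInstance.sum_size_le_sptCost {n : ℕ} (J : JobInstance n) :
    ∑ i, J.size i ≤ J.sptCost := by
  have : ∑ i, J.size i ≤ ∑ i, ∑ j, min (J.size i) (J.size j) := by
    refine Finset.sum_le_sum fun i _ => ?_
    have := Finset.single_le_sum (f := fun j => min (J.size i) (J.size j))
      (fun j _ => le_min (J.size_pos i).le (J.size_pos j).le) (Finset.mem_univ i)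
    simpa using this
  rw [JobInstance.sptCost]
  linarith

/-- Continuous induction on time: a closed property that can always be continued a little to the
right persists. It replaces any enumeration of the events of a schedule. -/
theorem NNReal.forall_le_of_isClosed_of_step {P : ℝ≥0 → Prop} (hcl : IsClosed {t | P t})
    (h0 : P 0) {T : ℝ≥0} (step : ∀ t < T, P t → ∃ u > t, ∀ s, t ≤ s → s ≤ u → P s) :
    ∀ t ≤ T, P t := by
  have := IsClosed.Icc_subset_of_forall_exists_gt (a := (0 : ℝ≥0)) (b := T) (s := {t | P t})
    (hcl.inter isClosed_Icc) h0 fun x hx y hy => by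
      obtain ⟨u, hu, hP⟩ := step x hx.2.2 hx.1
      exact ⟨min u y, hP _ (le_min hu.le (le_of_lt hy)) (min_le_left _ _), lt_min hu hy,
        min_le_right _ _⟩
  exact fun t ht => this ⟨zero_le, ht⟩

/-! ### Upper bound: mutual delays under the rule -/

namespace Schedule

variable {n : ℕ} {J : JobInstance n} {α : ℝ}

theorem Emitted.mono {S : Schedule J} {s t : ℝ≥0} {j : Fin n} (h : S.Emitted α s j)
    (hst : s ≤ t) : S.Emitted α t j :=
  le_trans h (S.mono j s t hst)

theorem emitted_of_size_le (S : Schedule J) (hα : α ≤ 1) {t : ℝ≥0} {j : Fin n}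
    (h : J.size j ≤ S.elapsed t j) : S.Emitted α t j :=
  (mul_le_of_le_one_left (J.size_pos j).le hα).trans h

theorem alive_anti (S : Schedule J) {s t : ℝ≥0} (h : s ≤ t) : S.alive t ⊆ S.alive s := by
  intro j hj
  rw [mem_alive] at *
  exact (S.mono j s t h).trans_lt hj

/-- If no unfinished job has emitted its signal, then the unfinished jobs share the machine for
some time. -/
theorem IsSignalRoundRobin.exists_share {S : Schedule J} (h : S.IsSignalRoundRobin α)
    (hα : α ≤ 1) {t : ℝ≥0} (hno : ∀ k ∈ S.alive t, ¬ S.Emitted α t k) :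
    ∃ u > t, ∀ s, t ≤ s → s ≤ u → ∀ j ∈ S.alive t,
      S.elapsed s j = S.elapsed t j + ((s : ℝ) - t) / ((S.alive t).card : ℝ) := by
  rcases (S.alive t).eq_empty_or_nonempty with he | hne
  · exact ⟨t + 1, by simp, by simp [he]⟩
  obtain ⟨k₀, hk₀, hmin⟩ := (S.alive t).exists_min_image
    (fun k => α * J.size k - S.elapsed t k) hne
  -- The least amount missing until a signal is a safe duration: no job is processed faster than at
  -- unit rate.
  have hpos : 0 < α * J.size k₀ - S.elapsed t k₀ := by
    have := hno k₀ hk₀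
    simp only [Emitted, not_le] at this
    linarith
  have hbefore : ∀ s, t ≤ s → s < t + (α * J.size k₀ - S.elapsed t k₀).toNNReal →
      ∀ k ∈ S.alive t, ¬ S.Emitted α s k := by
    intro s hts hs k hk
    have h1 := hmin k hk
    have h2 := S.elapsed_sub_le k hts
    have h3 : (s : ℝ) < t + (α * J.size k₀ - S.elapsed t k₀) := by
      have : (s : ℝ) < (t + (α * J.size k₀ - S.elapsed t k₀).toNNReal : ℝ≥0) := hs
      rwa [NNReal.coe_add, Real.coe_toNNReal _ hpos.le] at this
    simp only [Emitted, not_le]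
    linarith
  refine ⟨t + (α * J.size k₀ - S.elapsed t k₀).toNNReal, by simpa using hpos,
    fun s hts hs => h.roundRobin t s hts fun r htr hr => ?_⟩
  have hr' := hbefore r htr (hr.trans_le hs)
  refine ⟨(S.alive_anti htr).antisymm fun k hk => ?_, fun k hk => hr' k (S.alive_anti htr hk)⟩
  rw [mem_alive]
  by_contra! hk'
  exact hr' k hk (S.emitted_of_size_le hα hk')

theorem IsSignalRoundRobin.exists_step {S : Schedule J} (h : S.IsSignalRoundRobin α)
    (hα : α ≤ 1) (t : ℝ≥0) :
    (∃ u > t, ∀ s, t ≤ s → s ≤ u → ∀ j ∈ S.alive t,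
      S.elapsed s j = S.elapsed t j + ((s : ℝ) - t) / ((S.alive t).card : ℝ)) ∨
    ∃ i ∈ S.alive t, S.Emitted α t i ∧ ∃ u > t, ∀ s, t ≤ s → s ≤ u →
      S.elapsed s i = S.elapsed t i + ((s : ℝ) - t) ∧
      ∀ k ≠ i, S.elapsed s k = S.elapsed t k := by
  by_cases hno : ∀ k ∈ S.alive t, ¬ S.Emitted α t k
  · exact Or.inl (h.exists_share hα hno)
  · push Not at hno
    obtain ⟨i, hi, hem, hrun⟩ := h.preferential t hno
    have hi' := (S.mem_alive t i).1 hi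
    refine Or.inr ⟨i, hi, hem, t + (J.size i - S.elapsed t i).toNNReal, by simpa using hi',
      fun s hts hs => ?_⟩
    have h1 : (s : ℝ) ≤ t + (J.size i - S.elapsed t i) := by
      have : (s : ℝ) ≤ (t + (J.size i - S.elapsed t i).toNNReal : ℝ≥0) := hs
      rwa [NNReal.coe_add, Real.coe_toNNReal _ (by linarith)] at this
    have h2 := hrun (s - t) (by rw [NNReal.coe_sub hts]; linarith)
    rwa [add_tsub_cancel_of_le hts, NNReal.coe_sub hts] at h2

theorem IsSignalRoundRobin.sum_elapsed {S : Schedule J} (h : S.IsSignalRoundRobin α)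
    (hα : α ≤ 1) {T : ℝ≥0} (hT : ∀ t < T, (S.alive t).Nonempty) :
    ∑ j, S.elapsed T j = T := by
  refine NNReal.forall_le_of_isClosed_of_step (P := fun t => ∑ j, S.elapsed t j = (t : ℝ)) (T := T)
    (isClosed_eq (continuous_finsetSum _ fun j _ => S.continuous_elapsed j)
      NNReal.continuous_coe) (by simp [S.elapsed_zero]) (fun t ht hP => ?_) T le_rfl
  rcases h.exists_step hα t with ⟨u, hu, hs⟩ | ⟨i, hi, -, u, hu, hs⟩
  · refine ⟨u, hu, fun s hts hsu => ?_⟩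
    have : ∀ j, S.elapsed s j = S.elapsed t j +
        if j ∈ S.alive t then ((s : ℝ) - t) / ((S.alive t).card : ℝ) else 0 := by
      intro j
      split_ifs with hj
      · exact hs s hts hsu j hj
      · rw [mem_alive, not_lt] at hj
        rw [S.elapsed_eq_of_le hts hj, S.elapsed_eq_of_le le_rfl hj, add_zero]
    have hc : ((S.alive t).card : ℝ) ≠ 0 := by
      exact_mod_cast (Finset.card_pos.2 (hT t ht)).ne'
    simp only [this, Finset.sum_add_distrib, hP, Finset.sum_ite_mem, Finset.univ_inter,
      Finset.sum_const, nsmul_eq_mul]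
    field_simp
    ring
  · refine ⟨u, hu, fun s hts hsu => ?_⟩
    have : ∀ j, S.elapsed s j = S.elapsed t j + if j = i then ((s : ℝ) - t) else 0 := by
      intro j
      split_ifs with hj
      · rw [hj, (hs s hts hsu).1]
      · rw [(hs s hts hsu).2 j hj, add_zero]
    simp only [this, Finset.sum_add_distrib, hP, Finset.sum_ite_eq', Finset.mem_univ, if_true]
    ring

/-- The machine never idles while a job is unfinished, so a job that never finished would force the
total processing to exceed the sum of the sizes. -/
theorem IsSignalRoundRobin.exists_completesAt {S : Schedule J} (h : S.IsSignalRoundRobin α)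
    (hα : α ≤ 1) : ∃ C : Fin n → ℝ≥0, ∀ j, S.CompletesAt j (C j) := by
  suffices ∀ j, ∃ t, S.CompletesAt j t from Classical.axiomOfChoice this
  intro j
  set T : ℝ≥0 := (∑ i, J.size i).toNNReal + 1 with hTdef
  by_contra! hno
  have halive : ∀ t, j ∈ S.alive t := by
    intro t
    rw [mem_alive]
    by_contra! ht
    obtain ⟨s, -, hs⟩ := S.exists_completesAt ht
    exact hno s hs
  have h1 := h.sum_elapsed hα (T := T) fun t _ => ⟨j, halive t⟩
  have h2 : ∑ i, S.elapsed T i ≤ ∑ i, J.size i := Finset.sum_le_sum fun i _ => S.le_size T i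
  have h3 : ((T : ℝ≥0) : ℝ) = ∑ i, J.size i + 1 := by
    rw [hTdef, NNReal.coe_add, Real.coe_toNNReal _ (Finset.sum_nonneg fun i _ => (J.size_pos i).le),
      NNReal.coe_one]
  linarith

/-- Every job is run alone from some time on at which an `α` fraction of it is processed. -/
theorem IsSignalRoundRobin.exists_solo {S : Schedule J} (h : S.IsSignalRoundRobin α)
    (hα0 : 0 ≤ α) (hα : α ≤ 1) {j : Fin n} {C : ℝ≥0} (hC : S.CompletesAt j C) :
    ∃ a ≤ C, S.elapsed a j = α * J.size j ∧ ∀ k ≠ j, S.elapsed C k = S.elapsed a k := by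
  rcases hα.eq_or_lt with rfl | hlt
  · exact ⟨C, le_rfl, by rw [hC.1, one_mul], fun _ _ => rfl⟩
  have hp := J.size_pos j
  have hαp : α * J.size j < J.size j := by nlinarith
  -- The supremum of `A` is the last moment at which at most an `α` fraction is processed. The job
  -- may have emitted earlier and been kept waiting.
  set A : Set ℝ≥0 := {s | s ≤ C ∧ S.elapsed s j ≤ α * J.size j} with hA
  have hcl : IsClosed A := by
    rw [hA, Set.ofPred_and]
    exact isClosed_Iic.inter (isClosed_le (S.continuous_elapsed j) continuous_const)
  have hbdd : BddAbove A := ⟨C, fun s hs => hs.1⟩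
  have hmem := hcl.csSup_mem ⟨0, zero_le, by rw [S.elapsed_zero]; positivity⟩ hbdd
  set a := sSup A with ha
  have hafter : ∀ s, a < s → s ≤ C → α * J.size j < S.elapsed s j := by
    intro s has hs
    by_contra! hle
    exact absurd (le_csSup hbdd ⟨hs, hle⟩) (not_le.2 has)
  have haC : a < C := by
    refine lt_of_le_of_ne hmem.1 fun he => ?_
    have := hmem.2
    rw [he, hC.1] at this
    linarith
  have hea : S.elapsed a j = α * J.size j := by
    refine le_antisymm hmem.2 ?_
    by_contra! hlt'
    set d := min (α * J.size j - S.elapsed a j).toNNReal (C - a) with hd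
    have hdpos : 0 < d := lt_min (by simpa using hlt') (tsub_pos_of_lt haC)
    have h1 := hafter (a + d) (by simpa using hdpos)
      ((add_le_add le_rfl (min_le_right _ _)).trans (add_tsub_cancel_of_le haC.le).le)
    have h2 := S.elapsed_sub_le j (le_add_of_nonneg_right hdpos.le : a ≤ a + d)
    have h3 : (d : ℝ) ≤ α * J.size j - S.elapsed a j := by
      rw [← Real.coe_toNNReal (α * J.size j - S.elapsed a j) (by linarith)]
      exact_mod_cast min_le_left _ _
    rw [NNReal.coe_add] at h2
    linarith
  obtain ⟨i, hi, hem, hrun⟩ := h.preferential a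
    ⟨j, (S.mem_alive a j).2 (by linarith), hea.ge⟩
  have hi' := (S.mem_alive a i).1 hi
  -- Were another job served at time `a`, then `j` would stand still just after `a`, although `a` is
  -- the last moment at that level.
  have hij : i = j := by
    by_contra hne
    set d := min (J.size i - S.elapsed a i).toNNReal (C - a) with hd
    have hdpos : 0 < d := lt_min (by simpa using hi') (tsub_pos_of_lt haC)
    have h1 := hafter (a + d) (by simpa using hdpos)
      ((add_le_add le_rfl (min_le_right _ _)).trans (add_tsub_cancel_of_le haC.le).le)
    have h3 : (d : ℝ) ≤ J.size i - S.elapsed a i := by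
      rw [← Real.coe_toNNReal (J.size i - S.elapsed a i) (by linarith)]
      exact_mod_cast min_le_left _ _
    rw [(hrun d (by linarith)).2 j (Ne.symm hne)] at h1
    linarith
  subst hij
  have hCa : C ≤ a + (J.size i - S.elapsed a i).toNNReal := by
    refine hC.le_of_size_le ?_
    have := (hrun (J.size i - S.elapsed a i).toNNReal
      (by rw [Real.coe_toNNReal _ (by linarith)]; linarith)).1
    rw [this, Real.coe_toNNReal _ (by linarith)]
    linarith
  have hCa' : (C : ℝ) ≤ a + (J.size i - S.elapsed a i) := by
    have : (C : ℝ) ≤ (a + (J.size i - S.elapsed a i).toNNReal : ℝ≥0) := hCa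
    rwa [NNReal.coe_add, Real.coe_toNNReal _ (by linarith)] at this
  have := (hrun (C - a) (by rw [NNReal.coe_sub haC.le]; linarith)).2
  rw [add_tsub_cancel_of_le haC.le] at this
  exact ⟨a, haC.le, hea, this⟩

/-- Jobs receive the same processing until one of them emits its signal and is run alone. -/
theorem IsSignalRoundRobin.elapsed_eq_elapsed {S : Schedule J} (h : S.IsSignalRoundRobin α)
    (hα : α ≤ 1) {i j : Fin n} {a b A B : ℝ≥0} (hA : S.CompletesAt i A) (hB : S.CompletesAt j B)
    (haA : a ≤ A) (hbB : b ≤ B) (ha : S.elapsed a i = α * J.size i)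
    (hb : S.elapsed b j = α * J.size j) :
    ∀ t ≤ min a b, S.elapsed t i = S.elapsed t j := by
  -- A job that has emitted and is run alone moves strictly beyond its signal level, so this cannot
  -- happen before the time `c` at which it still sits at that level.
  have solo : ∀ {k : Fin n} {c t u : ℝ≥0}, S.elapsed c k = α * J.size k → S.Emitted α t k →
      t < c → t < u → (∀ s, t ≤ s → s ≤ u → S.elapsed s k = S.elapsed t k + ((s : ℝ) - t)) →
      False := by
    intro k c t u hc hem htc htu hs
    have h1 := hs (min u c) (le_min htu.le htc.le) (min_le_left _ _)
    have h2 := S.mono k _ _ (min_le_right u c)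
    have h3 : (t : ℝ) < (min u c : ℝ≥0) := lt_min htu htc
    have h4 : α * J.size k ≤ S.elapsed t k := hem
    linarith
  refine NNReal.forall_le_of_isClosed_of_step
    (isClosed_eq (S.continuous_elapsed i) (S.continuous_elapsed j))
    (by simp [S.elapsed_zero]) fun t ht hP => ?_
  have hta := ht.trans_le (min_le_left _ _)
  have htb := ht.trans_le (min_le_right _ _)
  have hi := (S.mem_alive t i).2 (hA.2 t (hta.trans_le haA))
  have hj := (S.mem_alive t j).2 (hB.2 t (htb.trans_le hbB))
  rcases h.exists_step hα t with ⟨u, hu, hs⟩ | ⟨k, hk, hem, u, hu, hs⟩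
  · exact ⟨u, hu, fun s hts hsu => by rw [hs s hts hsu i hi, hs s hts hsu j hj, hP]⟩
  · refine ⟨u, hu, fun s hts hsu => ?_⟩
    have hki : i ≠ k := by
      rintro rfl
      exact solo ha hem hta hu fun s h1 h2 => (hs s h1 h2).1
    have hkj : j ≠ k := by
      rintro rfl
      exact solo hb hem htb hu fun s h1 h2 => (hs s h1 h2).1
    rw [(hs s hts hsu).2 i hki, (hs s hts hsu).2 j hkj, hP]

/-- The job whose solo run starts first has received `α` times its size by then, and so has the
other, which then stands still until the first is done. Sizes are compared after multiplication by
`α`, which says nothing for `α = 0`; there the completion order takes over. For `α = 1` the solo run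
is empty and completions may coincide. -/
theorem IsSignalRoundRobin.pair {S : Schedule J} (h : S.IsSignalRoundRobin α)
    (hα0 : 0 ≤ α) (hα : α ≤ 1) {C : Fin n → ℝ≥0} (hC : ∀ j, S.CompletesAt j (C j))
    {i j : Fin n} (hij : i ≠ j) :
    (α * J.size j ≤ α * J.size i ∧ (α < 1 → C j < C i) ∧
      S.elapsed (C j) i + S.elapsed (C i) j = (1 + α) * J.size j) ∨
    (α * J.size i ≤ α * J.size j ∧ (α < 1 → C i < C j) ∧
      S.elapsed (C j) i + S.elapsed (C i) j = (1 + α) * J.size i) := by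
  have key : ∀ {i j : Fin n} {a b : ℝ≥0}, i ≠ j → a ≤ C i → b ≤ C j →
      S.elapsed a i = α * J.size i → S.elapsed b j = α * J.size j →
      (∀ k ≠ j, S.elapsed (C j) k = S.elapsed b k) → b ≤ a →
      (α * J.size j ≤ α * J.size i ∧ (α < 1 → C j < C i) ∧
      S.elapsed (C j) i + S.elapsed (C i) j = (1 + α) * J.size j) := by
    intro i j a b hij ha hb hea heb hsolo hba
    have h1 := h.elapsed_eq_elapsed hα (hC i) (hC j) ha hb hea heb b (by simp [hba])
    have h2 := hsolo i hij
    have h3 : α * J.size j ≤ α * J.size i := by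
      rw [← hea, ← heb, ← h1]
      exact S.mono i b a hba
    have h4 : α < 1 → C j < C i := by
      intro hlt
      by_contra! hle
      have := (hC i).elapsed_eq hle
      have := J.size_pos i
      nlinarith
    have h5 : C j ≤ C i := by
      rcases hα.eq_or_lt with rfl | hlt
      · refine ((hC j).le_of_size_le ?_ : C j ≤ b).trans (hba.trans ha)
        rw [heb, one_mul]
      · exact (h4 hlt).le
    refine ⟨h3, h4, ?_⟩
    rw [h2, h1, heb, (hC j).elapsed_eq h5]
    ring
  obtain ⟨a, ha, hea, hsa⟩ := h.exists_solo hα0 hα (hC i)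
  obtain ⟨b, hb, heb, hsb⟩ := h.exists_solo hα0 hα (hC j)
  rcases le_total b a with hba | hab
  · exact Or.inl (key hij ha hb hea heb hsb hba)
  · refine Or.inr ?_
    rw [add_comm]
    exact key hij.symm hb ha heb hea hsa hab

theorem IsSignalRoundRobin.totalCompletionTime_le {S : Schedule J} (h : S.IsSignalRoundRobin α)
    (hα0 : 0 ≤ α) (hα : α ≤ 1) (hs : 0 < α ∨ S.ShortestFirst) :
    S.totalCompletionTime ≤ ENNReal.ofReal ((1 + α) * J.sptCost) := by
  obtain ⟨C, hC⟩ := h.exists_completesAt hα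
  rw [S.totalCompletionTime_eq hC]
  refine ENNReal.ofReal_le_ofReal ?_
  have hsum : ∀ j, ∑ i, S.elapsed (C j) i = C j := fun j =>
    h.sum_elapsed hα fun t ht => ⟨j, (S.mem_alive t j).2 ((hC j).2 t ht)⟩
  have first : ∀ i j, α * J.size j ≤ α * J.size i → (α < 1 → C j < C i) →
      J.size j ≤ J.size i := by
    intro i j h1 h2
    rcases hs with hpos | hsf
    · exact le_of_mul_le_mul_left h1 hpos
    · rcases hα.eq_or_lt with rfl | hlt
      · simpa using h1
      · by_contra! hji
        have := hsf i j hji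
        rw [(hC i).completionTime_eq, (hC j).completionTime_eq, ENNReal.coe_le_coe] at this
        exact absurd this (not_le.2 (h2 hlt))
  -- The diagonal term `2 * p_i` is split as `(1 + α) * p_i + (1 - α) * p_i`, so that the minima
  -- range over all pairs. The claimed bound leaves a slack of `2 * α * ∑ p_i` before halving.
  have hpair : ∀ i j, S.elapsed (C j) i + S.elapsed (C i) j ≤
      (1 + α) * min (J.size i) (J.size j) + if i = j then (1 - α) * J.size i else 0 := by
    intro i j
    split_ifs with hij
    · subst hij
      rw [(hC i).1, min_self]
      linarith
    · rw [add_zero]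
      rcases h.pair hα0 hα hC hij with ⟨h1, h2, h3⟩ | ⟨h1, h2, h3⟩
      · rw [min_eq_right (first i j h1 h2), h3]
      · rw [min_eq_left (first j i h1 h2), h3]
  have h1 : ∑ i, ∑ j, (S.elapsed (C j) i + S.elapsed (C i) j) = 2 * ∑ j, (C j : ℝ) := by
    simp only [Finset.sum_add_distrib]
    rw [Finset.sum_comm]
    simp only [hsum]
    ring
  have h2 : ∑ i, ∑ j, (S.elapsed (C j) i + S.elapsed (C i) j) ≤ _ :=
    Finset.sum_le_sum fun i _ => Finset.sum_le_sum fun j _ => hpair i j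
  have hp : 0 ≤ ∑ i, J.size i := Finset.sum_nonneg fun i _ => (J.size_pos i).le
  rw [h1] at h2
  simp only [Finset.sum_add_distrib, ← Finset.mul_sum, Finset.sum_ite_eq, Finset.mem_univ,
    if_true] at h2
  rw [JobInstance.sptCost]
  nlinarith [mul_nonneg hα0 hp]

end Schedule

/-! ### Existence of schedules that follow the rule -/

section

variable {n : ℕ}

/-- The unfinished jobs, for processing times `p` and elapsed times `x`. -/
noncomputable def aliveSet (p x : Fin n → ℝ) : Finset (Fin n) :=
  Finset.univ.filter fun j => x j < p j

/-- The unfinished jobs that have emitted their signal. -/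
noncomputable def waitingSet (p : Fin n → ℝ) (α : ℝ) (x : Fin n → ℝ) : Finset (Fin n) :=
  Finset.univ.filter fun j => x j < p j ∧ α * p j ≤ x j

theorem mem_aliveSet {p x : Fin n → ℝ} {j : Fin n} : j ∈ aliveSet p x ↔ x j < p j := by
  simp [aliveSet]

theorem mem_waitingSet {p x : Fin n → ℝ} {α : ℝ} {j : Fin n} :
    j ∈ waitingSet p α x ↔ x j < p j ∧ α * p j ≤ x j := by
  simp [waitingSet]

/-- The elapsed times `e`, started from `x`, follow the rule; the waiting job that is served is
chosen by the relation `Pick`. -/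
structure IsRunFrom (p : Fin n → ℝ) (α : ℝ) (Pick : Finset (Fin n) → Fin n → Prop)
    (x : Fin n → ℝ) (e : ℝ≥0 → Fin n → ℝ) : Prop where
  zero : e 0 = x
  mono : ∀ j s t, s ≤ t → e s j ≤ e t j
  capacity : ∀ s t : ℝ≥0, s ≤ t → ∑ j, (e t j - e s j) ≤ (t : ℝ) - s
  le_size : ∀ t j, e t j ≤ p j
  share : ∀ t u : ℝ≥0, t ≤ u →
    (∀ s, t ≤ s → s < u → aliveSet p (e s) = aliveSet p (e t) ∧ waitingSet p α (e s) = ∅) →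
    ∀ j ∈ aliveSet p (e t), e u j = e t j + ((u : ℝ) - t) / ((aliveSet p (e t)).card : ℝ)
  serve : ∀ t, (waitingSet p α (e t)).Nonempty →
    ∃ i ∈ waitingSet p α (e t), Pick (waitingSet p α (e t)) i ∧
      ∀ s : ℝ≥0, e t i + (s : ℝ) ≤ p i →
        e (t + s) i = e t i + (s : ℝ) ∧ ∀ k ≠ i, e (t + s) k = e t k

/-- A run may be preceded by a segment with constant processing rates `ρ`. -/
theorem IsRunFrom.prepend {p : Fin n → ℝ} {α : ℝ} {Pick : Finset (Fin n) → Fin n → Prop}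
    {x ρ : Fin n → ℝ} {d : ℝ≥0} {e : ℝ≥0 → Fin n → ℝ} (hρ0 : ∀ j, 0 ≤ ρ j) (hρ1 : ∑ j, ρ j ≤ 1)
    (he : IsRunFrom p α Pick (fun j => x j + d * ρ j) e)
    (hshare : ∀ t < d, waitingSet p α (fun j => x j + t * ρ j) = ∅ →
      (∀ j ∈ aliveSet p (fun j => x j + t * ρ j),
        ρ j = 1 / ((aliveSet p (fun j => x j + t * ρ j)).card : ℝ)) ∧
      ¬ (aliveSet p (fun j => x j + d * ρ j) = aliveSet p (fun j => x j + t * ρ j) ∧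
        waitingSet p α (fun j => x j + d * ρ j) = ∅))
    (hserve : ∀ t < d, (waitingSet p α (fun j => x j + t * ρ j)).Nonempty →
      ∃ i ∈ waitingSet p α (fun j => x j + t * ρ j),
        Pick (waitingSet p α (fun j => x j + t * ρ j)) i ∧ ρ = Pi.single i 1 ∧
        x i + d = p i) :
    IsRunFrom p α Pick x (fun t => if t ≤ d then fun j => x j + t * ρ j else e (t - d)) := by
  set f : ℝ≥0 → Fin n → ℝ := fun t => if t ≤ d then fun j => x j + t * ρ j else e (t - d) with hf
  have f_le : ∀ t ≤ d, f t = fun j => x j + t * ρ j := fun t ht => if_pos ht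
  have f_ge : ∀ t, d ≤ t → f t = e (t - d) := by
    intro t ht
    rcases ht.eq_or_lt with rfl | ht
    · rw [f_le _ le_rfl, tsub_self, he.zero]
    · exact if_neg (not_le.2 ht)
  have f_add : ∀ t, f (d + t) = e t := fun t => by
    rw [f_ge _ (le_add_of_nonneg_right zero_le), add_tsub_cancel_left]
  have mono1 : ∀ j s t, s ≤ t → t ≤ d → f s j ≤ f t j := by
    intro j s t hst htd
    rw [f_le s (hst.trans htd), f_le t htd]
    have : (s : ℝ) ≤ t := hst
    nlinarith [hρ0 j]
  have mono2 : ∀ j s t, s ≤ t → d ≤ s → f s j ≤ f t j := by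
    intro j s t hst hds
    rw [f_ge s hds, f_ge t (hds.trans hst)]
    exact he.mono j _ _ (tsub_le_tsub_right hst d)
  have mono : ∀ j s t, s ≤ t → f s j ≤ f t j := by
    intro j s t hst
    rcases le_total t d with htd | hdt
    · exact mono1 j s t hst htd
    rcases le_total d s with hds | hsd
    · exact mono2 j s t hst hds
    · exact (mono1 j s d hsd le_rfl).trans (mono2 j d t hdt le_rfl)
  have cap1 : ∀ s t : ℝ≥0, s ≤ t → t ≤ d → ∑ j, (f t j - f s j) ≤ (t : ℝ) - s := by
    intro s t hst htd
    rw [f_le s (hst.trans htd), f_le t htd]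
    have h1 : (s : ℝ) ≤ t := hst
    have h2 : ∑ j, ((x j + t * ρ j) - (x j + s * ρ j)) = ((t : ℝ) - s) * ∑ j, ρ j := by
      rw [Finset.mul_sum]
      exact Finset.sum_congr rfl fun j _ => by ring
    rw [h2]
    nlinarith
  have cap2 : ∀ s t : ℝ≥0, s ≤ t → d ≤ s → ∑ j, (f t j - f s j) ≤ (t : ℝ) - s := by
    intro s t hst hds
    rw [f_ge s hds, f_ge t (hds.trans hst)]
    refine (he.capacity _ _ (tsub_le_tsub_right hst d)).trans ?_
    rw [NNReal.coe_sub hds, NNReal.coe_sub (hds.trans hst)]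
    linarith
  have lt_or : ∀ t, t < d ∨ ∃ r, t = d + r := fun t =>
    (lt_or_ge t d).imp_right fun h => ⟨t - d, (add_tsub_cancel_of_le h).symm⟩
  refine ⟨?_, mono, fun s t hst => ?_, fun t j => ?_, fun t u htu hcond => ?_, fun t hw => ?_⟩
  · rw [f_le 0 zero_le]
    simp
  · rcases le_total t d with htd | hdt
    · exact cap1 s t hst htd
    rcases le_total d s with hds | hsd
    · exact cap2 s t hst hds
    · have h1 := cap1 s d hsd le_rfl
      have h2 := cap2 d t hdt le_rfl
      have h3 : ∑ j, (f t j - f s j) = ∑ j, (f d j - f s j) + ∑ j, (f t j - f d j) := by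
        rw [← Finset.sum_add_distrib]
        exact Finset.sum_congr rfl fun j _ => by ring
      rw [h3]
      linarith
  · refine (mono j t (d + t) (le_add_of_nonneg_left zero_le)).trans ?_
    rw [f_add]
    exact he.le_size t j
  · rcases htu.eq_or_lt with rfl | htu'
    · simp
    rcases lt_or t with htd | ⟨r, rfl⟩
    · have hft := f_le t htd.le
      have h1 := (hcond t le_rfl htu').2
      rw [hft] at h1
      obtain ⟨h2, h3⟩ := hshare t htd h1
      rcases le_or_gt u d with hud | hdu
      · intro j hj
        rw [hft] at hj ⊢
        have := h2 j hj
        rw [f_le u hud, div_eq_mul_one_div, ← this]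
        ring
      -- A sharing interval cannot extend beyond `d`: by `hshare` the configuration at `d` violates
      -- its premise.
      · have := hcond d htd.le hdu
        rw [hft, f_le d le_rfl] at this
        exact absurd this h3
    · obtain ⟨v, rfl⟩ : ∃ v, u = d + v := (lt_or u).resolve_left
        (not_lt.2 ((le_add_of_nonneg_right zero_le).trans htu))
      rw [add_le_add_iff_left] at htu
      rw [f_add, f_add, NNReal.coe_add, NNReal.coe_add, add_sub_add_left_eq_sub]
      refine he.share r v htu fun s hrs hsv => ?_
      have := hcond (d + s) (by gcongr) (by gcongr)
      rwa [f_add, f_add] at this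
  · rcases lt_or t with htd | ⟨r, rfl⟩
    · have hft := f_le t htd.le
      rw [hft] at hw ⊢
      obtain ⟨i, hi, hP, hρ, hd⟩ := hserve t htd hw
      refine ⟨i, hi, hP, fun s hs => ?_⟩
      have hs' : t + s ≤ d := by
        rw [← NNReal.coe_le_coe, NNReal.coe_add]
        simp only [hρ, Pi.single_eq_same, mul_one] at hs
        linarith
      rw [f_le _ hs', hρ]
      refine ⟨by simp [add_assoc], fun k hk => by simp [hk]⟩
    · rw [f_add] at hw ⊢
      obtain ⟨i, hi, hP, hrun⟩ := he.serve r hw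
      refine ⟨i, hi, hP, fun s hs => ?_⟩
      rw [add_assoc, f_add]
      exact hrun s hs

/-- The run is a concatenation of segments with constant rates, each lasting until the next event.
The number of unfinished jobs plus the number of jobs that have not emitted drops with every
segment. -/
theorem exists_isRunFrom (p : Fin n → ℝ) {α : ℝ} (hp : ∀ j, 0 < p j) (hα : α ≤ 1)
    {Pick : Finset (Fin n) → Fin n → Prop} (hPick : ∀ E, E.Nonempty → ∃ i ∈ E, Pick E i) (m : ℕ) :
    ∀ x : Fin n → ℝ, (∀ j, x j ≤ p j) →
      (aliveSet p x).card + (aliveSet (fun j => α * p j) x).card ≤ m →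
      ∃ e, IsRunFrom p α Pick x e := by
  induction m with
  | zero =>
    intro x hx hm
    have hA : aliveSet p x = ∅ := by
      rw [← Finset.card_eq_zero]
      omega
    have hW : waitingSet p α x = ∅ := by
      refine Finset.eq_empty_of_forall_notMem fun j hj => ?_
      have := mem_aliveSet.2 (mem_waitingSet.1 hj).1
      simp [hA] at this
    exact ⟨fun _ => x, rfl, fun _ _ _ _ => le_rfl, fun s t h => by simpa using h,
      fun _ => hx, fun _ _ _ _ j hj => by simp [hA] at hj, fun _ h => by simp [hW] at h⟩
  | succ m ih =>
    intro x hx hm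
    rcases (waitingSet p α x).eq_empty_or_nonempty with hW | hW
    · rcases (aliveSet p x).eq_empty_or_nonempty with hA | hA
      · exact ih x hx (by
          have : aliveSet (fun j => α * p j) x ⊆ aliveSet p x := fun j hj => by
            rw [mem_aliveSet] at *
            nlinarith [hp j]
          rw [hA, Finset.subset_empty] at this
          simp [this, hA])
      obtain ⟨k₀, hk₀, hmin⟩ := (aliveSet p x).exists_min_image (fun k => α * p k - x k) hA
      have hbelow : ∀ k ∈ aliveSet p x, x k < α * p k := by
        intro k hk
        by_contra! h
        have := mem_waitingSet.2 ⟨mem_aliveSet.1 hk, h⟩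
        simp [hW] at this
      set c : ℝ := ((aliveSet p x).card : ℝ) with hc
      have hcpos : 0 < c := by
        rw [hc]
        exact_mod_cast Finset.card_pos.2 hA
      set δ := α * p k₀ - x k₀ with hδ
      have hδpos : 0 < δ := sub_pos.2 (hbelow k₀ hk₀)
      set ρ : Fin n → ℝ := fun j => if j ∈ aliveSet p x then 1 / c else 0 with hρ
      -- With `c` jobs sharing the machine, the job closest to its signal needs `c * δ` time units
      -- to emit.
      set d : ℝ≥0 := ⟨c * δ, by positivity⟩ with hd
      have hdρ : ∀ j ∈ aliveSet p x, (d : ℝ) * ρ j = δ := by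
        intro j hj
        rw [show (d : ℝ) = c * δ from rfl]
        simp only [hρ, hj, if_true]
        field_simp
      have hρd : ∀ j ∉ aliveSet p x, ρ j = 0 := fun j hj => by simp [hρ, hj]
      have hρ0 : ∀ j, 0 ≤ ρ j := by
        intro j
        simp only [hρ]
        split_ifs <;> positivity
      have hstay : ∀ t < d, ∀ j ∈ aliveSet p x, x j + t * ρ j < α * p j := by
        intro t ht j hj
        have h1 := hmin j hj
        have h2 := hdρ j hj
        have h3 : (t : ℝ) < d := ht
        have h4 : (t : ℝ) * ρ j < d * ρ j := by
          refine mul_lt_mul_of_pos_right h3 ?_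
          simp only [hρ, hj, if_true]
          positivity
        linarith
      have halive : ∀ t < d, aliveSet p (fun j => x j + t * ρ j) = aliveSet p x := by
        intro t ht
        ext j
        rw [mem_aliveSet]
        constructor
        · intro h
          rw [mem_aliveSet]
          have := mul_nonneg t.2 (hρ0 j)
          exact lt_of_le_of_lt (le_add_of_nonneg_right this) h
        · intro h
          have := hstay t ht j h
          nlinarith [hp j]
      have hwait : ∀ t < d, waitingSet p α (fun j => x j + t * ρ j) = ∅ := by
        intro t ht
        refine Finset.eq_empty_of_forall_notMem fun j hj => ?_
        have h1 := mem_waitingSet.1 hj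
        have h2 := (mem_aliveSet (x := fun j => x j + t * ρ j)).2 h1.1
        rw [halive t ht] at h2
        exact absurd h1.2 (not_le.2 (hstay t ht j h2))
      have hend : x k₀ + d * ρ k₀ = α * p k₀ := by
        rw [hdρ k₀ hk₀]
        ring
      have hx' : ∀ j, x j + d * ρ j ≤ p j := by
        intro j
        by_cases hj : j ∈ aliveSet p x
        · have h1 := hmin j hj
          rw [hdρ j hj]
          nlinarith [hp j]
        · simpa [hρd j hj] using hx j
      have hle : ∀ j, x j ≤ x j + d * ρ j := fun j =>
        le_add_of_nonneg_right (mul_nonneg d.2 (hρ0 j))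
      obtain ⟨e, he⟩ := ih (fun j => x j + d * ρ j) hx' (by
        have h1 : aliveSet p (fun j => x j + d * ρ j) ⊆ aliveSet p x := fun j hj =>
          mem_aliveSet.2 ((hle j).trans_lt (mem_aliveSet.1 hj))
        have h2 : aliveSet (fun j => α * p j) (fun j => x j + d * ρ j) ⊂
            aliveSet (fun j => α * p j) x := by
          refine (Finset.ssubset_iff_of_subset fun j hj =>
            mem_aliveSet.2 ((hle j).trans_lt (mem_aliveSet.1 hj))).2
            ⟨k₀, mem_aliveSet.2 (hbelow k₀ hk₀), fun h => ?_⟩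
          have := mem_aliveSet.1 h
          rw [hend] at this
          exact lt_irrefl _ this
        have := Finset.card_le_card h1
        have := Finset.card_lt_card h2
        omega)
      refine ⟨_, he.prepend hρ0 ?_ (fun t ht _ => ?_) fun t ht h => ?_⟩
      · simp only [hρ, Finset.sum_ite_mem, Finset.univ_inter, Finset.sum_const, nsmul_eq_mul]
        rw [← hc]
        field_simp
        exact le_rfl
      · rw [halive t ht]
        refine ⟨fun j hj => by simp [hρ, hj, hc], fun ⟨h1, h2⟩ => ?_⟩
        rw [← h1] at hk₀
        have := mem_waitingSet.2 ⟨mem_aliveSet.1 hk₀, hend.ge⟩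
        simp [h2] at this
      · rw [hwait t ht] at h
        simp at h
    · obtain ⟨i, hi, hP⟩ := hPick _ hW
      have hi' := mem_waitingSet.1 hi
      set d : ℝ≥0 := ⟨p i - x i, by linarith⟩ with hd
      have hdi : (d : ℝ) = p i - x i := rfl
      set ρ : Fin n → ℝ := Pi.single i 1 with hρ
      have hρi : ρ i = 1 := by simp [hρ]
      have hρk : ∀ k ≠ i, ρ k = 0 := fun k hk => by simp [hρ, hk]
      have hρ0 : ∀ j, 0 ≤ ρ j := by
        intro j
        by_cases hj : j = i
        · simp [hj, hρi]
        · simp [hρk j hj]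
      have hx' : ∀ j, x j + d * ρ j ≤ p j := by
        intro j
        by_cases hj : j = i
        · rw [hj, hρi, hdi]
          linarith
        · simpa [hρk j hj] using hx j
      have hle : ∀ j, x j ≤ x j + d * ρ j := fun j =>
        le_add_of_nonneg_right (mul_nonneg d.2 (hρ0 j))
      have hwait : ∀ t < d, waitingSet p α (fun j => x j + t * ρ j) = waitingSet p α x := by
        intro t ht
        have h3 : (t : ℝ) < d := ht
        ext j
        rw [mem_waitingSet, mem_waitingSet]
        by_cases hj : j = i
        · rw [hj, hρi]
          refine iff_of_true ⟨by linarith, ?_⟩ hi'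
          have := t.2
          linarith
        · rw [hρk j hj, mul_zero, add_zero]
      obtain ⟨e, he⟩ := ih (fun j => x j + d * ρ j) hx' (by
        have h1 : aliveSet (fun j => α * p j) (fun j => x j + d * ρ j) ⊆
            aliveSet (fun j => α * p j) x := fun j hj =>
          mem_aliveSet.2 ((hle j).trans_lt (mem_aliveSet.1 hj))
        have h2 : aliveSet p (fun j => x j + d * ρ j) ⊂ aliveSet p x := by
          refine (Finset.ssubset_iff_of_subset fun j hj =>
            mem_aliveSet.2 ((hle j).trans_lt (mem_aliveSet.1 hj))).2
            ⟨i, mem_aliveSet.2 hi'.1, fun h => ?_⟩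
          have := mem_aliveSet.1 h
          rw [hρi, hdi] at this
          linarith
        have := Finset.card_le_card h1
        have := Finset.card_lt_card h2
        omega)
      refine ⟨_, he.prepend hρ0 (by simp [hρ]) (fun t ht h => ?_) fun t ht _ => ?_⟩
      · rw [hwait t ht] at h
        simp [h] at hW
      · rw [hwait t ht]
        exact ⟨i, hi, hP, hρ, by rw [hdi]; ring⟩

namespace Schedule

variable {J : JobInstance n} {α : ℝ}

/-- The rule, where the waiting job that is served is chosen by the relation `Pick`. -/
structure IsPickRoundRobin (S : Schedule J) (α : ℝ) (Pick : Finset (Fin n) → Fin n → Prop) :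
    Prop where
  isSignalRoundRobin : S.IsSignalRoundRobin α
  serve : ∀ t, (waitingSet J.size α (S.elapsed t)).Nonempty →
    ∃ i ∈ waitingSet J.size α (S.elapsed t), Pick (waitingSet J.size α (S.elapsed t)) i ∧
      ∀ s : ℝ≥0, S.elapsed t i + (s : ℝ) ≤ J.size i →
        S.elapsed (t + s) i = S.elapsed t i + (s : ℝ) ∧
        ∀ k ≠ i, S.elapsed (t + s) k = S.elapsed t k

theorem exists_isPickRoundRobin (J : JobInstance n) (hα : α ≤ 1)
    {Pick : Finset (Fin n) → Fin n → Prop} (hPick : ∀ E, E.Nonempty → ∃ i ∈ E, Pick E i) :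
    ∃ S : Schedule J, S.IsPickRoundRobin α Pick := by
  obtain ⟨e, he⟩ := exists_isRunFrom J.size J.size_pos hα hPick _ 0
    (fun j => (J.size_pos j).le) le_rfl
  have hwait : ∀ t j, j ∈ waitingSet J.size α (e t) ↔
      e t j < J.size j ∧ α * J.size j ≤ e t j := fun t j => mem_waitingSet
  refine ⟨⟨e, fun j => by rw [he.zero]; rfl, he.mono, he.capacity, he.le_size⟩,
    ⟨fun t u htu hcond => he.share t u htu fun s hts hsu => ⟨(hcond s hts hsu).1, ?_⟩, ?_⟩,
    he.serve⟩
  · refine Finset.eq_empty_of_forall_notMem fun j hj => ?_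
    have h := (hwait s j).1 hj
    exact (hcond s hts hsu).2 j (mem_aliveSet.2 h.1) h.2
  · rintro t ⟨j, hj, hem⟩
    obtain ⟨i, hi, -, hrun⟩ := he.serve t ⟨j, (hwait t j).2 ⟨mem_aliveSet.1 hj, hem⟩⟩
    have hi' := (hwait t i).1 hi
    exact ⟨i, mem_aliveSet.2 hi'.1, hi'.2, hrun⟩

end Schedule

end

/-! ### The rule as an online algorithm -/

namespace Schedule

variable {n : ℕ} {J J' : JobInstance n} {α : ℝ}

theorem displayed_of_size_le (S : Schedule J) {t : ℝ≥0} {j : Fin n}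
    (h : J.size j ≤ S.elapsed t j) : S.displayed α t j = 1 := by
  have : S.elapsed t j / J.size j = 1 := by
    rw [S.elapsed_eq_of_le le_rfl h, div_self (J.size_pos j).ne']
  simp [displayed, progressBar, this]

theorem displayed_of_emitted (S : Schedule J) {t : ℝ≥0} {j : Fin n}
    (h : S.elapsed t j < J.size j) (hem : S.Emitted α t j) : S.displayed α t j = α := by
  have h1 : S.elapsed t j / J.size j < 1 := (div_lt_one (J.size_pos j)).2 h
  have h2 : α ≤ S.elapsed t j / J.size j := (le_div_iff₀ (J.size_pos j)).2 hem
  simp [displayed, progressBar, h1, h2, h1.ne]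

theorem displayed_of_not_emitted (S : Schedule J) (hα : α ≤ 1) {t : ℝ≥0} {j : Fin n}
    (hem : ¬ S.Emitted α t j) : S.displayed α t j = 0 := by
  have h2 : S.elapsed t j / J.size j < α := (div_lt_iff₀ (J.size_pos j)).2 (not_le.1 hem)
  have h1 : S.elapsed t j / J.size j ≠ 1 := by
    intro h
    linarith
  simp [displayed, progressBar, h2, h1]

theorem mem_aliveSet_iff_displayed (S : Schedule J) (hα : α ≤ 1) {t : ℝ≥0} {j : Fin n} :
    j ∈ aliveSet J.size (S.elapsed t) ↔ S.displayed α t j ≠ 1 := by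
  rw [mem_aliveSet]
  rcases lt_or_ge (S.elapsed t j) (J.size j) with h | h
  · by_cases hem : S.Emitted α t j
    · rw [S.displayed_of_emitted h hem]
      have h2 : α * J.size j ≤ S.elapsed t j := hem
      refine iff_of_true h fun h1 => ?_
      rw [h1, one_mul] at h2
      linarith
    · simp [S.displayed_of_not_emitted hα hem, h]
  · simp [S.displayed_of_size_le h, h]

/-- Positivity of `α` is essential: for `α = 0` a waiting job displays `0`. -/
theorem mem_waitingSet_iff_displayed (S : Schedule J) (hα0 : 0 < α) (hα : α ≤ 1) {t : ℝ≥0}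
    {j : Fin n} : j ∈ waitingSet J.size α (S.elapsed t) ↔
      S.displayed α t j ≠ 1 ∧ S.displayed α t j ≠ 0 := by
  rw [mem_waitingSet, ← mem_aliveSet, S.mem_aliveSet_iff_displayed hα]
  refine and_congr_right fun h => ?_
  rw [← S.mem_aliveSet_iff_displayed hα, mem_aliveSet] at h
  by_cases hem : S.Emitted α t j
  · rw [S.displayed_of_emitted h hem]
    exact iff_of_true hem hα0.ne'
  · rw [S.displayed_of_not_emitted hα hem]
    exact iff_of_false hem (by simp)

/-- The schedules produced by the rule with fixed tie-breaking are determined by the displayed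
progress. -/
theorem IsPickRoundRobin.elapsed_eq {Pick : Finset (Fin n) → Fin n → Prop}
    {S : Schedule J} {S' : Schedule J'} (h : S.IsPickRoundRobin α Pick)
    (h' : S'.IsPickRoundRobin α Pick) (hα0 : 0 < α) (hα : α ≤ 1)
    (hPick : ∀ E, ∀ i ∈ E, ∀ j ∈ E, Pick E i → Pick E j → i = j) {T : ℝ≥0}
    (hT : ∀ t < T, ∀ j, S.displayed α t j = S'.displayed α t j) (j : Fin n) :
    S.elapsed T j = S'.elapsed T j := by
  refine NNReal.forall_le_of_isClosed_of_step
    (P := fun t => ∀ j, S.elapsed t j = S'.elapsed t j) (T := T) ?_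
    (fun j => by rw [S.elapsed_zero, S'.elapsed_zero]) (fun t ht hP => ?_) T le_rfl j
  · rw [Set.ofPred_forall]
    exact isClosed_iInter fun j => isClosed_eq (S.continuous_elapsed j) (S'.continuous_elapsed j)
  have halive : aliveSet J'.size (S'.elapsed t) = aliveSet J.size (S.elapsed t) := by
    ext k
    rw [S.mem_aliveSet_iff_displayed hα, S'.mem_aliveSet_iff_displayed hα, hT t ht k]
  have hwait : waitingSet J'.size α (S'.elapsed t) = waitingSet J.size α (S.elapsed t) := by
    ext k
    rw [S.mem_waitingSet_iff_displayed hα0 hα, S'.mem_waitingSet_iff_displayed hα0 hα, hT t ht k]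
  rcases (waitingSet J.size α (S.elapsed t)).eq_empty_or_nonempty with hW | hW
  · have hno : ∀ {J : JobInstance n} (S : Schedule J), waitingSet J.size α (S.elapsed t) = ∅ →
        ∀ k ∈ S.alive t, ¬ S.Emitted α t k := by
      intro J S hW k hk hem
      have := mem_waitingSet.2 ⟨(S.mem_alive t k).1 hk, hem⟩
      simp [hW] at this
    obtain ⟨u, hu, hrun⟩ := h.isSignalRoundRobin.exists_share hα (hno S hW)
    obtain ⟨u', hu', hrun'⟩ := h'.isSignalRoundRobin.exists_share hα (hno S' (hwait.trans hW))
    refine ⟨min u u', lt_min hu hu', fun s hts hs k => ?_⟩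
    by_cases hk : k ∈ aliveSet J.size (S.elapsed t)
    · have h1 := hrun s hts (hs.trans (min_le_left _ _)) k hk
      have h2 := hrun' s hts (hs.trans (min_le_right _ _)) k (halive ▸ hk :)
      rw [h1, h2, hP k]
      have : (S'.alive t).card = (S.alive t).card := congrArg Finset.card halive
      rw [this]
    · have hk' := hk
      rw [← halive] at hk'
      rw [mem_aliveSet, not_lt] at hk hk'
      rw [S.elapsed_eq_of_le hts hk, S'.elapsed_eq_of_le hts hk', ← S.elapsed_eq_of_le le_rfl hk,
        ← S'.elapsed_eq_of_le le_rfl hk', hP k]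
  · obtain ⟨i, hi, hPi, hrun⟩ := h.serve t hW
    obtain ⟨i', hi', hPi', hrun'⟩ := h'.serve t (hwait ▸ hW :)
    rw [hwait] at hi' hPi'
    obtain rfl := hPick _ i hi i' hi' hPi hPi'
    have h1 := (mem_waitingSet.1 hi).1
    have h2 := (mem_waitingSet.1 (hwait ▸ hi :)).1
    -- The served job may have different sizes in the two instances; both schedules run it alone at
    -- least until the smaller remainder is used up.
    set d := (min (J.size i - S.elapsed t i) (J'.size i - S'.elapsed t i)).toNNReal with hd
    have hdpos : 0 < d := by simp [hd, h1, h2]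
    have hd' : (d : ℝ) = min (J.size i - S.elapsed t i) (J'.size i - S'.elapsed t i) :=
      Real.coe_toNNReal _ (le_min (by linarith) (by linarith))
    refine ⟨t + d, by simpa using hdpos, fun s hts hs k => ?_⟩
    obtain ⟨r, rfl⟩ : ∃ r, s = t + r := ⟨s - t, (add_tsub_cancel_of_le hts).symm⟩
    have hr : (r : ℝ) ≤ d := by exact_mod_cast (add_le_add_iff_left t).1 hs
    rw [hd', le_min_iff] at hr
    have h3 := hrun r (by linarith)
    have h4 := hrun' r (by linarith)
    by_cases hk : k = i
    · rw [hk, h3.1, h4.1, hP i]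
    · rw [h3.2 k hk, h4.2 k hk, hP k]

/-- If all signals are emitted at time `0` and the shortest unfinished job is always served, then
shorter jobs are completed first. -/
theorem IsPickRoundRobin.shortestFirst {S : Schedule J}
    (h : S.IsPickRoundRobin 0 fun E i => ∀ k ∈ E, J.size i ≤ J.size k) : S.ShortestFirst := by
  intro i j hij
  obtain ⟨C, hC⟩ := h.isSignalRoundRobin.exists_completesAt zero_le_one
  rw [(hC i).completionTime_eq, (hC j).completionTime_eq, ENNReal.coe_le_coe]
  by_contra! hlt
  suffices ∀ t ≤ C j, S.elapsed t j = 0 from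
    absurd ((hC j).1.symm.trans (this _ le_rfl)) (J.size_pos j).ne'
  refine NNReal.forall_le_of_isClosed_of_step
    (isClosed_eq (S.continuous_elapsed j) continuous_const) (S.elapsed_zero j) fun t ht hP => ?_
  have hi : i ∈ waitingSet J.size 0 (S.elapsed t) := by
    rw [mem_waitingSet, zero_mul]
    exact ⟨(hC i).2 t (ht.trans hlt), S.elapsed_nonneg t i⟩
  obtain ⟨k, hk, hPk, hrun⟩ := h.serve t ⟨i, hi⟩
  have hk' := (mem_waitingSet.1 hk).1
  have hkj : j ≠ k := by
    rintro rfl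
    exact absurd (hPk i hi) (not_le.2 hij)
  refine ⟨t + (J.size k - S.elapsed t k).toNNReal, by simpa using hk', fun s hts hs => ?_⟩
  obtain ⟨r, rfl⟩ : ∃ r, s = t + r := ⟨s - t, (add_tsub_cancel_of_le hts).symm⟩
  have hr : (r : ℝ) ≤ J.size k - S.elapsed t k := by
    rw [← Real.coe_toNNReal (J.size k - S.elapsed t k) (by linarith)]
    exact_mod_cast (add_le_add_iff_left t).1 hs
  rw [(hrun r (by linarith)).2 j hkj, hP]

theorem exists_isSignalRoundRobin_shortestFirst (J : JobInstance n) :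
    ∃ S : Schedule J, S.IsSignalRoundRobin 0 ∧ S.ShortestFirst := by
  obtain ⟨S, hS⟩ := exists_isPickRoundRobin J zero_le_one
    (Pick := fun E i => ∀ k ∈ E, J.size i ≤ J.size k) fun E hE => E.exists_min_image J.size hE
  exact ⟨S, hS.isSignalRoundRobin, hS.shortestFirst⟩

end Schedule

/-- At `α = 0` the upper bound `(1 + α) * sptCost` meets the lower bound, so the rule itself
provides an optimal schedule. -/
theorem JobInstance.opt_eq {n : ℕ} (J : JobInstance n) : J.opt = ENNReal.ofReal J.sptCost := by
  refine le_antisymm ?_ J.sptCost_le_opt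
  obtain ⟨S, hS, hsf⟩ := Schedule.exists_isSignalRoundRobin_shortestFirst J
  have := hS.totalCompletionTime_le le_rfl zero_le_one (Or.inr hsf)
  rw [add_zero, one_mul] at this
  exact (J.opt_le S).trans this

theorem exists_onlineAlgorithm_isSignalRoundRobin {α : ℝ} (hα0 : 0 < α) (hα : α ≤ 1) (n : ℕ) :
    ∃ A : OnlineAlgorithm α n, ∀ J, (A.run J).IsSignalRoundRobin α := by
  choose run hrun using fun J : JobInstance n => Schedule.exists_isPickRoundRobin J hα
    -- Breaking ties by the smallest index makes the choice unique and independent of the unknown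
    -- sizes.
    (Pick := fun E i => ∀ k ∈ E, i ≤ k) fun E hE => E.exists_min_image id hE
  refine ⟨⟨run, fun J J' t ht => (hrun J).elapsed_eq (hrun J') hα0 hα ?_ ht⟩,
    fun J => (hrun J).isSignalRoundRobin⟩
  exact fun E i hi j hj h1 h2 => le_antisymm (h1 j hj) (h2 i hi)

theorem OnlineAlgorithm.competitiveRatio_le {α : ℝ} (hα0 : 0 < α) (hα : α ≤ 1)
    (A : ∀ n : ℕ, OnlineAlgorithm α n)
    (hA : ∀ (n : ℕ) (J : JobInstance n), ((A n).run J).IsSignalRoundRobin α) :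
    competitiveRatio (fun n => (A n).toRandomized) ≤ ENNReal.ofReal (1 + α) := by
  refine iSup₂_le fun n J => ENNReal.div_le_of_le_mul ?_
  rw [J.opt_eq, ← ENNReal.ofReal_mul (by linarith)]
  have : (A n).toRandomized.expectedCost J = ((A n).run J).totalCompletionTime := by
    change @lintegral _ (A n).toRandomized.mΩ (A n).toRandomized.μ
      (fun _ => ((A n).run J).totalCompletionTime) = _
    refine (@lintegral_const _ (A n).toRandomized.mΩ (A n).toRandomized.μ _).trans ?_
    rw [(A n).toRandomized.isProb.measure_univ, mul_one]
  rw [this]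
  exact (hA n J).totalCompletionTime_le hα0.le hα (Or.inl hα0)

/-! ### Lower bound: what an online algorithm knows about a pair of jobs -/

namespace Schedule

variable {n : ℕ} {J J' : JobInstance n} {α : ℝ}

theorem eventually_displayed_eq (S : Schedule J) (hα : α ≤ 1) (t : ℝ≥0) (j : Fin n) :
    ∀ᶠ s in nhdsWithin t (Set.Ici t), S.displayed α s j = S.displayed α t j := by
  have hlt : ∀ {b : ℝ}, S.elapsed t j < b → ∀ᶠ s in nhdsWithin t (Set.Ici t),
      S.elapsed s j < b := fun hb =>
    ((S.continuous_elapsed j).continuousAt.eventually_lt_const hb).filter_mono nhdsWithin_le_nhds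
  rcases lt_or_ge (S.elapsed t j) (J.size j) with h | h
  · by_cases hem : S.Emitted α t j
    · filter_upwards [hlt h, self_mem_nhdsWithin] with s hs hts
      rw [S.displayed_of_emitted hs (hem.mono hts), S.displayed_of_emitted h hem]
    · filter_upwards [hlt (not_le.1 hem)] with s hs
      rw [S.displayed_of_not_emitted hα (not_le.2 hs), S.displayed_of_not_emitted hα hem]
  · filter_upwards [self_mem_nhdsWithin] with s hts
    rw [S.displayed_of_size_le h, S.displayed_of_size_le (h.trans (S.mono j t s hts))]

theorem CompletesAt.unique {S : Schedule J} {j : Fin n} {s t : ℝ≥0} (hs : S.CompletesAt j s)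
    (ht : S.CompletesAt j t) : s = t :=
  le_antisymm (hs.le_of_size_le ht.1.ge) (ht.le_of_size_le hs.1.ge)

/-- Two jobs delay each other by at least the size of the one that is completed first and the part
of the other one that is processed by then. -/
theorem min_add_max_le (S : Schedule J) (hα : α ≤ 1) {C : Fin n → ℝ≥0}
    (hC : ∀ j, S.CompletesAt j (C j)) (i j : Fin n) :
    min (J.size i) (J.size j) + α * max (J.size i) (J.size j) -
      max (α * J.size j - S.elapsed (C i) j) 0 - max (α * J.size i - S.elapsed (C j) i) 0 ≤
      S.elapsed (C j) i + S.elapsed (C i) j := by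
  -- As `α ≤ 1`, giving the full weight to the smaller number minimizes `x + α * y`; hence it does
  -- not matter which job is completed first.
  have key : ∀ x y : ℝ, min x y + α * max x y ≤ x + α * y := by
    intro x y
    rcases le_total x y with h | h
    · rw [min_eq_left h, max_eq_right h]
    · rw [min_eq_right h, max_eq_left h]
      nlinarith
  have h1 := le_max_left (α * J.size j - S.elapsed (C i) j) 0
  have h2 := le_max_right (α * J.size j - S.elapsed (C i) j) 0
  have h3 := le_max_left (α * J.size i - S.elapsed (C j) i) 0
  have h4 := le_max_right (α * J.size i - S.elapsed (C j) i) 0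
  rcases le_total (C i) (C j) with h | h
  · have := (hC i).elapsed_eq h
    have := key (J.size i) (J.size j)
    linarith
  · have := (hC j).elapsed_eq h
    have := key (J.size j) (J.size i)
    rw [min_comm, max_comm] at this
    linarith

/-- A job that has not emitted when another one is completed finishes strictly later, so this cannot
hold in both directions. -/
theorem indicator_add_indicator_le (S : Schedule J) (hα : α ≤ 1) {C : Fin n → ℝ≥0}
    (hC : ∀ j, S.CompletesAt j (C j)) (i j : Fin n) :
    (if S.elapsed (C i) j < α * J.size j then (1 : ℝ) else 0) +
      (if S.elapsed (C j) i < α * J.size i then (1 : ℝ) else 0) ≤ 1 := by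
  have key : ∀ {i j : Fin n}, S.elapsed (C i) j < α * J.size j → C i < C j := by
    intro i j h
    by_contra! hle
    rw [(hC j).elapsed_eq hle] at h
    nlinarith [J.size_pos j]
  split_ifs with h1 h2
  · exact absurd (key h1) (key h2).not_gt
  all_goals norm_num

end Schedule

namespace OnlineAlgorithm

variable {n : ℕ} {α : ℝ}

/-- An online algorithm does not learn the size of a job before that job emits its signal. -/
theorem elapsed_eq_of_not_emitted (A : OnlineAlgorithm α n) (hα : α ≤ 1)
    {J J' : JobInstance n} {j : Fin n} (hsize : ∀ k ≠ j, J.size k = J'.size k) {T : ℝ≥0}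
    (h : (A.run J).elapsed T j < α * J.size j) (h' : (A.run J).elapsed T j < α * J'.size j) :
    ∀ t ≤ T, ∀ k, (A.run J).elapsed t k = (A.run J').elapsed t k := by
  intro t ht
  refine A.nonanticipating J J' t ?_
  refine NNReal.forall_le_of_isClosed_of_step
    (P := fun t => ∀ s, s < t → ∀ k, (A.run J).displayed α s k = (A.run J').displayed α s k)
    (T := T) ?_ (fun s hs => absurd hs not_lt_zero) (fun t ht hP => ?_) t ht
  · have : {t : ℝ≥0 | ∀ s, s < t → ∀ k,
        (A.run J).displayed α s k = (A.run J').displayed α s k} =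
        ⋂ (s : ℝ≥0) (_ : ¬ ∀ k, (A.run J).displayed α s k = (A.run J').displayed α s k),
          Set.Iic s := by
      ext t
      simp only [Set.mem_ofPred_eq, Set.mem_iInter, Set.mem_Iic]
      exact forall_congr' fun s => by rw [← not_lt, not_imp_not]
    rw [this]
    exact isClosed_iInter fun s => isClosed_iInter fun _ => isClosed_Iic
  have heq := A.nonanticipating J J' t hP
  -- Before its signal, job `j` displays `0` in both instances, so its size is invisible; the other
  -- jobs have equal sizes.
  have hdisp : ∀ k, (A.run J).displayed α t k = (A.run J').displayed α t k := by
    intro k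
    by_cases hk : k = j
    · subst hk
      have := (A.run J).mono k t T ht.le
      rw [Schedule.displayed_of_not_emitted _ hα (not_le.2 (this.trans_lt h)),
        Schedule.displayed_of_not_emitted _ hα (not_le.2 ((heq k ▸ this).trans_lt h'))]
    · rw [Schedule.displayed, Schedule.displayed, heq, hsize k hk]
  have hev : ∀ᶠ s in nhdsWithin t (Set.Ici t), ∀ k,
      (A.run J).displayed α s k = (A.run J').displayed α s k := by
    rw [Filter.eventually_all]
    intro k
    filter_upwards [(A.run J).eventually_displayed_eq hα t k,
      (A.run J').eventually_displayed_eq hα t k] with s h1 h2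
    rw [h1, h2, hdisp]
  obtain ⟨u, hu, hsub⟩ := mem_nhdsGE_iff_exists_Ico_subset.1 hev
  refine ⟨u, hu, fun s _ hsu r hr => ?_⟩
  rcases lt_or_ge r t with hrt | htr
  · exact hP r hrt
  · exact hsub ⟨htr, hr.trans_le hsu⟩

theorem completesAt_of_not_emitted (A : OnlineAlgorithm α n) (hα : α ≤ 1)
    {J J' : JobInstance n} {i j : Fin n} (hij : i ≠ j) (hsize : ∀ k ≠ j, J.size k = J'.size k)
    {T : ℝ≥0} (hT : (A.run J).CompletesAt i T)
    (h : (A.run J).elapsed T j < α * J.size j) (h' : (A.run J).elapsed T j < α * J'.size j) :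
    (A.run J').CompletesAt i T ∧ (A.run J').elapsed T j = (A.run J).elapsed T j := by
  have heq := A.elapsed_eq_of_not_emitted hα hsize h h'
  refine ⟨⟨?_, fun s hs => ?_⟩, (heq T le_rfl j).symm⟩
  · rw [← heq T le_rfl, hT.1, hsize i hij]
  · rw [← heq s hs.le, ← hsize i hij]
    exact hT.2 s hs

/-- Among instances that differ in the size of job `j` only, those for which another job `i` is
completed before `j` emits its signal are those for which the size of `j` exceeds some level `w`,
and the processing of `j` is then the same. -/
theorem exists_level (A : OnlineAlgorithm α n) (hα0 : 0 < α) (hα : α ≤ 1) {ι : Type*}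
    {I : ι → JobInstance n} {i j : Fin n} (hij : i ≠ j)
    (hsize : ∀ y y', ∀ k ≠ j, (I y).size k = (I y').size k) {C : ι → ℝ≥0}
    (hC : ∀ y, (A.run (I y)).CompletesAt i (C y)) :
    (∀ y, α * (I y).size j ≤ (A.run (I y)).elapsed (C y) j) ∨
    ∃ w, 0 ≤ w ∧ ∀ y, (w < (I y).size j ∧ (A.run (I y)).elapsed (C y) j = α * w) ∨
      ((I y).size j ≤ w ∧ α * (I y).size j ≤ (A.run (I y)).elapsed (C y) j) := by
  have key : ∀ y y', (A.run (I y)).elapsed (C y) j < α * (I y).size j →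
      (A.run (I y)).elapsed (C y) j < α * (I y').size j →
      (A.run (I y')).elapsed (C y') j = (A.run (I y)).elapsed (C y) j := by
    intro y y' h h'
    obtain ⟨h1, h2⟩ := A.completesAt_of_not_emitted hα hij (hsize y y') (hC y) h h'
    rw [(hC y').unique h1, h2]
  by_contra! hno
  obtain ⟨⟨y₀, hy₀⟩, hno⟩ := hno
  -- The level is read off from any one instance in which the signal of `j` is still missing when
  -- `i` is completed; all larger sizes produce the same run up to that time.
  set w := (A.run (I y₀)).elapsed (C y₀) j / α with hw
  have hαw : (A.run (I y₀)).elapsed (C y₀) j = α * w := by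
    rw [hw]
    field_simp
  obtain ⟨y, h1, h2⟩ := hno w (div_nonneg (Schedule.elapsed_nonneg _ _ _) hα0.le)
  rcases lt_or_ge w ((I y).size j) with h | h
  · refine h1 h ?_
    rw [← hαw]
    refine key y₀ y hy₀ ?_
    rw [hαw]
    exact mul_lt_mul_of_pos_left h hα0
  · have h3 := h2 h
    have h4 : α * (I y).size j ≤ α * w := mul_le_mul_of_nonneg_left h hα0.le
    have h5 := key y y₀ h3 (h3.trans (h4.trans_lt (hαw ▸ hy₀)))
    linarith

end OnlineAlgorithm

/-! ### Independent sizes with a truncated geometric distribution -/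

section ProductWeights

variable {n : ℕ} {S : Type*} [Fintype S] {w : S → ℝ}

theorem sum_prod_weight (hw : ∑ y, w y = 1) : ∑ f : Fin n → S, ∏ i, w (f i) = 1 := by
  classical
  have := Finset.prod_univ_sum (fun _ : Fin n => (Finset.univ : Finset S)) fun _ y => w y
  rw [Fintype.piFinset_univ] at this
  rw [← this]
  simp [hw]

/-- Resampling coordinate `j` does not change an expectation: exchanging `f j` with an independent
copy `y` is a weight-preserving involution. -/
theorem sum_prod_weight_mul_eq_sum_update (hw : ∑ y, w y = 1) (j : Fin n)
    (F : (Fin n → S) → ℝ) :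
    ∑ f : Fin n → S, (∏ i, w (f i)) * F f =
      ∑ f : Fin n → S, (∏ i, w (f i)) * ∑ y, w y * F (Function.update f j y) := by
  set φ : (Fin n → S) × S → (Fin n → S) × S := fun z => (Function.update z.1 j z.2, z.1 j)
    with hφ
  have hinv : Function.Involutive φ := by
    rintro ⟨f, y⟩
    simp [hφ]
  have hweight : ∀ z : (Fin n → S) × S,
      (∏ i, w ((φ z).1 i)) * w (φ z).2 = (∏ i, w (z.1 i)) * w z.2 := by
    rintro ⟨f, y⟩
    rw [← Finset.mul_prod_erase _ _ (Finset.mem_univ j),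
      ← Finset.mul_prod_erase Finset.univ (fun i => w (f i)) (Finset.mem_univ j)]
    have : ∏ i ∈ Finset.univ.erase j, w (Function.update f j y i) =
        ∏ i ∈ Finset.univ.erase j, w (f i) :=
      Finset.prod_congr rfl fun i hi => by rw [Function.update_of_ne (Finset.ne_of_mem_erase hi)]
    simp only [hφ, Function.update_self, this]
    ring
  calc ∑ f : Fin n → S, (∏ i, w (f i)) * F f
      = ∑ z : (Fin n → S) × S, ((∏ i, w (z.1 i)) * w z.2) * F z.1 := by
        rw [Fintype.sum_prod_type]
        refine Finset.sum_congr rfl fun f _ => ?_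
        have : ∀ y, (∏ i, w (f i)) * w y * F f = (∏ i, w (f i)) * F f * w y := fun y =>
          mul_right_comm _ _ _
        simp only [this, ← Finset.mul_sum, hw, mul_one]
    _ = ∑ z : (Fin n → S) × S, ((∏ i, w ((φ z).1 i)) * w (φ z).2) * F (φ z).1 :=
        (Equiv.sum_comp hinv.toPerm
          fun z : (Fin n → S) × S => ((∏ i, w (z.1 i)) * w z.2) * F z.1).symm
    _ = _ := by
        simp only [hweight]
        rw [Fintype.sum_prod_type]
        simp only [hφ, mul_assoc, ← Finset.mul_sum]

theorem sum_prod_weight_mul_le (hw : ∑ y, w y = 1) (hw0 : ∀ y, 0 ≤ w y) (j : Fin n) {c : ℝ}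
    {F G : (Fin n → S) → ℝ} (h : ∀ f, ∑ y, w y * F (Function.update f j y) ≤
      c * ∑ y, w y * G (Function.update f j y)) :
    ∑ f : Fin n → S, (∏ i, w (f i)) * F f ≤ c * ∑ f : Fin n → S, (∏ i, w (f i)) * G f := by
  rw [sum_prod_weight_mul_eq_sum_update hw j F, sum_prod_weight_mul_eq_sum_update hw j G,
    Finset.mul_sum]
  refine Finset.sum_le_sum fun f _ => ?_
  rw [mul_left_comm]
  exact mul_le_mul_of_nonneg_left (h f) (Finset.prod_nonneg fun k _ => hw0 (f k))

theorem sum_prod_weight_mul_apply (hw : ∑ y, w y = 1) (i : Fin n) (g : S → ℝ) :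
    ∑ f : Fin n → S, (∏ k, w (f k)) * g (f i) = ∑ y, w y * g y := by
  rw [sum_prod_weight_mul_eq_sum_update hw i]
  simp only [Function.update_self, ← Finset.sum_mul, sum_prod_weight hw, one_mul]

theorem sum_prod_weight_mul_apply_apply (hw : ∑ y, w y = 1) {i j : Fin n} (hij : i ≠ j)
    (g : S → S → ℝ) :
    ∑ f : Fin n → S, (∏ k, w (f k)) * g (f i) (f j) = ∑ x, w x * ∑ y, w y * g x y := by
  rw [sum_prod_weight_mul_eq_sum_update hw j]
  simp only [Function.update_self, Function.update_of_ne hij]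
  exact sum_prod_weight_mul_apply hw i fun x => ∑ y, w y * g x y

end ProductWeights

/-- The truncated geometric distribution: `k` has weight `(1 - q) * q ^ k` for `k < M`, and `M` has
the remaining weight `q ^ M`. -/
noncomputable def geomWeight (q : ℝ) : ∀ M : ℕ, Fin (M + 1) → ℝ
  | 0 => fun _ => 1
  | M + 1 => Fin.cons (1 - q) fun k => q * geomWeight q M k

/-- Conditioning on the first trial; the expectations below are computed by induction on `M` through
this recursion. -/
theorem sum_geomWeight_succ_mul (q : ℝ) (M : ℕ) (F : Fin (M + 2) → ℝ) :
    ∑ k, geomWeight q (M + 1) k * F k =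
      (1 - q) * F 0 + q * ∑ k, geomWeight q M k * F k.succ := by
  rw [Fin.sum_univ_succ, Finset.mul_sum]
  simp [geomWeight, mul_assoc]

theorem geomWeight_pos {q : ℝ} (hq0 : 0 < q) (hq : q < 1) (M : ℕ) (k : Fin (M + 1)) :
    0 < geomWeight q M k := by
  induction M with
  | zero => simp [geomWeight]
  | succ M ih =>
    refine Fin.cases ?_ (fun k => ?_) k
    · simp [geomWeight, hq]
    · simpa [geomWeight] using mul_pos hq0 (ih k)

theorem sum_geomWeight (q : ℝ) (M : ℕ) : ∑ k, geomWeight q M k = 1 := by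
  induction M with
  | zero => simp [geomWeight]
  | succ M ih =>
    have := sum_geomWeight_succ_mul q M fun _ => 1
    simp only [mul_one, ih] at this
    rw [this]
    ring

theorem sum_geomWeight_mul_val {q : ℝ} (hq : q < 1) (M : ℕ) :
    ∑ k, geomWeight q M k * ((k : ℝ) + 1) = (1 - q ^ (M + 1)) / (1 - q) := by
  have h1 : 1 - q ≠ 0 := (sub_pos.2 hq).ne'
  induction M with
  | zero => simp [geomWeight, h1]
  | succ M ih =>
    rw [sum_geomWeight_succ_mul]
    simp only [Fin.val_succ, Nat.cast_succ, Fin.val_zero, Nat.cast_zero]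
    simp only [mul_add _ (_ + 1) (1 : ℝ), Finset.sum_add_distrib, mul_one, sum_geomWeight, ih]
    field_simp
    ring

/-- The minimum of two independent copies is again truncated geometric, with parameter `q ^ 2`. -/
theorem sum_geomWeight_mul_min {q : ℝ} (hq0 : 0 ≤ q) (hq : q < 1) (M : ℕ) :
    ∑ k, geomWeight q M k * ∑ l, geomWeight q M l * min ((k : ℝ) + 1) ((l : ℝ) + 1) =
      (1 - (q ^ 2) ^ (M + 1)) / (1 - q ^ 2) := by
  have h1 : 1 - q ^ 2 ≠ 0 := by nlinarith
  induction M with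
  | zero => simp [geomWeight, h1]
  | succ M ih =>
    have h2 : ∀ x : ℝ, 0 ≤ x → min 1 (x + 1) = 1 := fun x hx => min_eq_left (by linarith)
    have h3 : ∀ x : ℝ, 0 ≤ x → min (x + 1) 1 = 1 := fun x hx => min_eq_right (by linarith)
    have h4 : ∀ x y : ℝ, min (x + 1 + 1) (y + 1 + 1) = min (x + 1) (y + 1) + 1 := fun x y =>
      min_add_add_right _ _ _
    have hk : ∀ k : ℕ, (0 : ℝ) ≤ (k : ℝ) + 1 := fun k => by positivity
    rw [sum_geomWeight_succ_mul]
    simp only [sum_geomWeight_succ_mul]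
    simp only [Fin.val_succ, Nat.cast_succ, Fin.val_zero, Nat.cast_zero, zero_add, min_self,
      h2 _ (hk _), h3 _ (hk _), h4]
    simp only [mul_add, Finset.sum_add_distrib, mul_one, sum_geomWeight, mul_left_comm _ q,
      ← Finset.mul_sum, ← Finset.sum_mul, ih]
    field_simp
    ring

/-- The mean residual life of the truncated geometric distribution is at most `1 / (1 - q)`. -/
theorem sum_geomWeight_residual_le {q : ℝ} (hq0 : 0 ≤ q) (hq : q < 1) (M : ℕ) :
    ∀ w : ℝ, 0 ≤ w → ∑ k, geomWeight q M k * max ((k : ℝ) + 1 - w) 0 ≤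
      1 / (1 - q) * ∑ k, geomWeight q M k * if w < (k : ℝ) + 1 then 1 else 0 := by
  have h1 : 0 < 1 - q := sub_pos.2 hq
  have hc : 1 ≤ 1 / (1 - q) := by
    rw [le_div_iff₀ h1]
    linarith
  have hsmall : ∀ (M : ℕ) (w : ℝ), 0 ≤ w → w < 1 →
      ∑ k, geomWeight q M k * max ((k : ℝ) + 1 - w) 0 ≤
      1 / (1 - q) * ∑ k, geomWeight q M k * if w < (k : ℝ) + 1 then 1 else 0 := by
    intro M w hw hw1
    have h2 : ∀ k : Fin (M + 1), w < (k : ℝ) + 1 := fun k => by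
      have : (0 : ℝ) ≤ (k : ℝ) := by positivity
      linarith
    have h3 : ∀ k : Fin (M + 1), max ((k : ℝ) + 1 - w) 0 = (k : ℝ) + 1 - w := fun k =>
      max_eq_left (by linarith [h2 k])
    simp only [h2, h3, if_true, mul_one, sum_geomWeight, mul_sub _ (_ + 1 : ℝ), Finset.sum_sub_distrib,
      sum_geomWeight_mul_val hq, ← Finset.sum_mul, one_mul]
    have : (1 - q ^ (M + 1)) / (1 - q) ≤ 1 / (1 - q) := by
      gcongr
      have := pow_nonneg hq0 (M + 1)
      linarith
    linarith
  induction M with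
  | zero =>
    intro w hw
    rcases lt_or_ge w 1 with h | h
    · exact hsmall 0 w hw h
    · simp [h.not_gt, h]
  | succ M ih =>
    intro w hw
    rcases lt_or_ge w 1 with h | h
    · exact hsmall (M + 1) w hw h
    -- Memorylessness: beyond the first value the distribution is a shifted copy, seen from level `w
    -- - 1`.
    · have h2 := mul_le_mul_of_nonneg_left (ih (w - 1) (by linarith)) hq0
      have h3 : max (1 - w) 0 = 0 := max_eq_right (by linarith)
      have h4 : ∀ x : ℝ, x + 1 - (w - 1) = x + 1 + 1 - w := fun x => by ring
      simp only [sub_lt_iff_lt_add, h4] at h2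
      rw [sum_geomWeight_succ_mul, sum_geomWeight_succ_mul]
      simp only [Fin.val_succ, Nat.cast_succ, Fin.val_zero, Nat.cast_zero, zero_add, h3,
        h.not_gt, if_false, mul_zero]
      linarith

/-! ### Expected costs on random instances -/

section

variable {n M : ℕ}

/-- The instance with processing times `f i + 1`. -/
noncomputable def gridInstance (f : Fin n → Fin (M + 1)) : JobInstance n where
  size i := (f i : ℝ) + 1
  size_pos i := by positivity

theorem gridInstance_size (f : Fin n → Fin (M + 1)) (i : Fin n) :
    (gridInstance f).size i = (f i : ℝ) + 1 := rfl

theorem sum_sum_ite_eq (n : ℕ) (a b : ℝ) :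
    ∑ i : Fin n, ∑ j : Fin n, (if i = j then a else b) = n * a + n * (n - 1) * b := by
  have : ∀ i j : Fin n, (if i = j then a else b) = b + if i = j then a - b else 0 := by
    intro i j
    split_ifs <;> ring
  simp only [this, Finset.sum_add_distrib, Finset.sum_ite_eq, Finset.mem_univ, if_true,
    Finset.sum_const, Finset.card_univ, Fintype.card_fin, nsmul_eq_mul]
  ring

theorem sum_weight_mul_size {q : ℝ} (hq : q < 1) (i : Fin n) :
    ∑ f : Fin n → Fin (M + 1), (∏ k, geomWeight q M (f k)) * (gridInstance f).size i =
      (1 - q ^ (M + 1)) / (1 - q) := by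
  simp only [gridInstance_size]
  rw [sum_prod_weight_mul_apply (sum_geomWeight q M) i fun y => (y : ℝ) + 1,
    sum_geomWeight_mul_val hq]

theorem sum_weight_mul_min {q : ℝ} (hq0 : 0 ≤ q) (hq : q < 1) {i j : Fin n} (hij : i ≠ j) :
    ∑ f : Fin n → Fin (M + 1), (∏ k, geomWeight q M (f k)) *
      min ((gridInstance f).size i) ((gridInstance f).size j) =
      (1 - (q ^ 2) ^ (M + 1)) / (1 - q ^ 2) := by
  simp only [gridInstance_size]
  rw [sum_prod_weight_mul_apply_apply (sum_geomWeight q M) hij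
    fun x y => min ((x : ℝ) + 1) ((y : ℝ) + 1), sum_geomWeight_mul_min hq0 hq]

theorem sum_weight_mul_sptCost {q : ℝ} (hq0 : 0 ≤ q) (hq : q < 1) :
    ∑ f : Fin n → Fin (M + 1), (∏ k, geomWeight q M (f k)) * (gridInstance f).sptCost =
      (n * (2 * ((1 - q ^ (M + 1)) / (1 - q))) +
        n * (n - 1) * ((1 - (q ^ 2) ^ (M + 1)) / (1 - q ^ 2))) / 2 := by
  have h1 : ∀ i j : Fin n, ∑ f : Fin n → Fin (M + 1), (∏ k, geomWeight q M (f k)) *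
      min ((gridInstance f).size i) ((gridInstance f).size j) =
      if i = j then (1 - q ^ (M + 1)) / (1 - q) else
        (1 - (q ^ 2) ^ (M + 1)) / (1 - q ^ 2) := by
    intro i j
    split_ifs with hij
    · simp only [hij, min_self, sum_weight_mul_size hq]
    · exact sum_weight_mul_min hq0 hq hij
  have h2 : ∀ F G : (Fin n → Fin (M + 1)) → ℝ, ∑ f, (∏ k, geomWeight q M (f k)) *
      ((F f + G f) / 2) = (∑ f, (∏ k, geomWeight q M (f k)) * F f +
        ∑ f, (∏ k, geomWeight q M (f k)) * G f) / 2 := by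
    intro F G
    rw [← Finset.sum_add_distrib, Finset.sum_div]
    exact Finset.sum_congr rfl fun f _ => by ring
  simp only [JobInstance.sptCost]
  rw [h2]
  simp only [Finset.mul_sum]
  rw [Finset.sum_comm]
  simp only [sum_weight_mul_size hq]
  rw [Finset.sum_comm (γ := Fin n → Fin (M + 1))]
  have h3 : ∀ i : Fin n, ∑ f : Fin n → Fin (M + 1), ∑ j : Fin n, (∏ k, geomWeight q M (f k)) *
      min ((gridInstance f).size i) ((gridInstance f).size j) =
      ∑ j : Fin n, if i = j then (1 - q ^ (M + 1)) / (1 - q) else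
        (1 - (q ^ 2) ^ (M + 1)) / (1 - q ^ 2) := fun i => by
    rw [Finset.sum_comm]
    exact Finset.sum_congr rfl fun j _ => h1 i j
  simp only [h3]
  rw [sum_sum_ite_eq, Finset.sum_const, Finset.card_univ, Fintype.card_fin, nsmul_eq_mul]
  ring

namespace OnlineAlgorithm

variable {α q : ℝ}

/-- All sizes except that of `j` are fixed. By `exists_level` the missing amount is then `α` times
the excess of the size over a fixed level, and the bound on the mean residual life applies. -/
theorem sum_weight_mul_residual_le (A : OnlineAlgorithm α n) (hα0 : 0 < α) (hα : α ≤ 1)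
    (hq0 : 0 < q) (hq : q < 1) {C : (Fin n → Fin (M + 1)) → Fin n → ℝ≥0}
    (hC : ∀ f j, (A.run (gridInstance f)).CompletesAt j (C f j)) {i j : Fin n} (hij : i ≠ j) :
    ∑ f, (∏ k, geomWeight q M (f k)) * max (α * (gridInstance f).size j -
      (A.run (gridInstance f)).elapsed (C f i) j) 0 ≤
    α * (1 / (1 - q)) * ∑ f, (∏ k, geomWeight q M (f k)) *
      (if (A.run (gridInstance f)).elapsed (C f i) j < α * (gridInstance f).size j
        then 1 else 0) := by
  refine sum_prod_weight_mul_le (sum_geomWeight q M) (fun y => (geomWeight_pos hq0 hq M y).le) j fun f => ?_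
  have hsize : ∀ y, (gridInstance (Function.update f j y)).size j = (y : ℝ) + 1 := fun y => by
    rw [gridInstance_size, Function.update_self]
  rcases A.exists_level hα0 hα (I := fun y => gridInstance (Function.update f j y)) hij
    (fun y y' k hk => by simp only [gridInstance_size, Function.update_of_ne hk])
    (fun y => hC (Function.update f j y) i) with h | ⟨w, hw, h⟩
  · have h1 : ∀ y, max (α * (gridInstance (Function.update f j y)).size j -
        (A.run (gridInstance (Function.update f j y))).elapsed (C (Function.update f j y) i) j) 0
        = 0 := fun y => max_eq_right (by linarith [h y])
    have h2 : ∀ y, ¬ (A.run (gridInstance (Function.update f j y))).elapsed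
        (C (Function.update f j y) i) j < α * (gridInstance (Function.update f j y)).size j :=
      fun y => not_lt.2 (h y)
    simp [h1, h2]
  · have h1 : ∀ y, max (α * (gridInstance (Function.update f j y)).size j -
        (A.run (gridInstance (Function.update f j y))).elapsed (C (Function.update f j y) i) j) 0
        = α * max ((y : ℝ) + 1 - w) 0 := by
      intro y
      rw [← hsize y]
      rcases h y with ⟨h1, h2⟩ | ⟨h1, h2⟩
      · rw [h2, ← mul_sub, max_eq_left (by nlinarith), max_eq_left (by linarith)]
      · rw [max_eq_right (by linarith), max_eq_right (by linarith), mul_zero]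
    have h2 : ∀ y, (A.run (gridInstance (Function.update f j y))).elapsed
        (C (Function.update f j y) i) j < α * (gridInstance (Function.update f j y)).size j ↔
        w < (y : ℝ) + 1 := by
      intro y
      rw [← hsize y]
      rcases h y with ⟨h1, h2⟩ | ⟨h1, h2⟩
      · rw [h2]
        exact iff_of_true (mul_lt_mul_of_pos_left h1 hα0) h1
      · exact iff_of_false (not_lt.2 h2) (not_lt.2 h1)
    simp only [h1, h2, mul_left_comm _ α, ← Finset.mul_sum]
    rw [mul_assoc]
    exact mul_le_mul_of_nonneg_left (sum_geomWeight_residual_le hq0.le hq M w hw) hα0.le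

theorem le_sum_weight_mul_cost (A : OnlineAlgorithm α n) (hα0 : 0 < α) (hα : α ≤ 1)
    (hq0 : 0 < q) (hq : q < 1) {C : (Fin n → Fin (M + 1)) → Fin n → ℝ≥0}
    (hC : ∀ f j, (A.run (gridInstance f)).CompletesAt j (C f j)) :
    (n * (2 * ((1 - q ^ (M + 1)) / (1 - q))) +
      n * (n - 1) * ((1 - α) * ((1 - (q ^ 2) ^ (M + 1)) / (1 - q ^ 2)) +
        α * (2 * ((1 - q ^ (M + 1)) / (1 - q))) - α * (1 / (1 - q)))) / 2 ≤
    ∑ f, (∏ k, geomWeight q M (f k)) * ∑ j, (C f j : ℝ) := by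
  set W : (Fin n → Fin (M + 1)) → ℝ := fun f => ∏ k, geomWeight q M (f k) with hW
  have hW0 : ∀ f, 0 ≤ W f := fun f =>
    Finset.prod_nonneg fun k _ => (geomWeight_pos hq0 hq M (f k)).le
  set m := (1 - q ^ (M + 1)) / (1 - q) with hm
  set μ := (1 - (q ^ 2) ^ (M + 1)) / (1 - q ^ 2) with hμ
  set e : (Fin n → Fin (M + 1)) → Fin n → Fin n → ℝ := fun f i j =>
    (A.run (gridInstance f)).elapsed (C f i) j with he
  have hpair : ∀ i j : Fin n, (if i = j then 2 * m else
      ((1 - α) * μ + α * (2 * m) - α * (1 / (1 - q)))) ≤ ∑ f, W f * (e f j i + e f i j) := by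
    intro i j
    split_ifs with hij
    · subst hij
      have : ∀ f, W f * (e f i i + e f i i) = 2 * (W f * (gridInstance f).size i) := by
        intro f
        rw [he]
        simp only
        rw [(hC f i).1]
        ring
      simp only [this, ← Finset.mul_sum]
      rw [hW, sum_weight_mul_size hq]
    set ρ : Fin n → Fin n → (Fin n → Fin (M + 1)) → ℝ := fun i j f =>
      max (α * (gridInstance f).size j - e f i j) 0 with hρ
    set χ : Fin n → Fin n → (Fin n → Fin (M + 1)) → ℝ := fun i j f =>
      if e f i j < α * (gridInstance f).size j then 1 else 0 with hχ
    have h1 : ∑ f, W f * ρ i j f ≤ α * (1 / (1 - q)) * ∑ f, W f * χ i j f :=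
      A.sum_weight_mul_residual_le hα0 hα hq0 hq hC hij
    have h2 : ∑ f, W f * ρ j i f ≤ α * (1 / (1 - q)) * ∑ f, W f * χ j i f :=
      A.sum_weight_mul_residual_le hα0 hα hq0 hq hC (Ne.symm hij)
    -- The two events are disjoint, so the loss `α / (1 - q)` is paid only once per pair.
    have h3 : ∑ f, W f * χ i j f + ∑ f, W f * χ j i f ≤ 1 := by
      rw [← sum_prod_weight (n := n) (sum_geomWeight q M), ← Finset.sum_add_distrib]
      refine Finset.sum_le_sum fun f _ => ?_
      rw [← mul_add]
      exact mul_le_of_le_one_right (hW0 f)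
        ((A.run (gridInstance f)).indicator_add_indicator_le hα (hC f) i j)
    have h4 : ∑ f, W f * ((1 - α) * min ((gridInstance f).size i) ((gridInstance f).size j) +
        α * ((gridInstance f).size i + (gridInstance f).size j) - ρ i j f - ρ j i f) ≤
        ∑ f, W f * (e f j i + e f i j) := by
      refine Finset.sum_le_sum fun f _ => mul_le_mul_of_nonneg_left ?_ (hW0 f)
      have := (A.run (gridInstance f)).min_add_max_le hα (hC f) i j
      refine le_trans (le_of_eq ?_) this
      rw [← min_add_max ((gridInstance f).size i) ((gridInstance f).size j)]
      ring
    have h5 : ∑ f, W f * ((1 - α) * min ((gridInstance f).size i) ((gridInstance f).size j) +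
        α * ((gridInstance f).size i + (gridInstance f).size j) - ρ i j f - ρ j i f) =
        (1 - α) * ∑ f, W f * min ((gridInstance f).size i) ((gridInstance f).size j) +
        α * (∑ f, W f * (gridInstance f).size i + ∑ f, W f * (gridInstance f).size j) -
        ∑ f, W f * ρ i j f - ∑ f, W f * ρ j i f := by
      rw [← Finset.sum_add_distrib, Finset.mul_sum, Finset.mul_sum, ← Finset.sum_add_distrib,
        ← Finset.sum_sub_distrib, ← Finset.sum_sub_distrib]
      exact Finset.sum_congr rfl fun f _ => by ring
    have h6 : ∑ f, W f * min ((gridInstance f).size i) ((gridInstance f).size j) = μ :=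
      sum_weight_mul_min hq0.le hq hij
    have h7 : ∀ i, ∑ f, W f * (gridInstance f).size i = m := sum_weight_mul_size hq
    rw [h5, h6, h7, h7] at h4
    have h8 : 0 ≤ α * (1 / (1 - q)) := mul_nonneg hα0.le (one_div_nonneg.2 (by linarith))
    have h9 := mul_le_mul_of_nonneg_left h3 h8
    linarith
  have h1 : ∑ i : Fin n, ∑ j : Fin n, ∑ f, W f * (e f j i + e f i j) ≤
      2 * ∑ f, W f * ∑ j, (C f j : ℝ) := by
    have : ∑ i : Fin n, ∑ j : Fin n, ∑ f, W f * (e f j i + e f i j) =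
        ∑ f, W f * ∑ i, ∑ j, (e f j i + e f i j) := by
      simp only [Finset.mul_sum]
      rw [Finset.sum_comm (γ := Fin n → Fin (M + 1))]
      exact Finset.sum_congr rfl fun i _ => Finset.sum_comm
    rw [this, Finset.mul_sum]
    refine Finset.sum_le_sum fun f _ => ?_
    rw [mul_left_comm]
    exact mul_le_mul_of_nonneg_left ((A.run (gridInstance f)).sum_sum_elapsed_le (C f)) (hW0 f)
  have h2 := (Finset.sum_le_sum fun i (_ : i ∈ Finset.univ) =>
    Finset.sum_le_sum fun j (_ : j ∈ Finset.univ) => hpair i j).trans h1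
  rw [sum_sum_ite_eq] at h2
  linarith

end OnlineAlgorithm

end

/-! ### Randomized algorithms and Yao's principle -/

/-- By monotonicity rational times suffice; a countable infimum makes the cost measurable. -/
theorem Schedule.completionTime_eq_iInf_rat {n : ℕ} {J : JobInstance n} (S : Schedule J)
    (j : Fin n) : S.completionTime j =
      ⨅ t : ℚ, if J.size j ≤ S.elapsed (Real.toNNReal t) j then (Real.toNNReal t : ℝ≥0∞) else ⊤ := by
  refine le_antisymm (le_iInf fun t => ?_) (le_iInf₂ fun t ht => ?_)
  · split_ifs with h
    · exact iInf₂_le (Real.toNNReal t) h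
    · exact le_top
  · refine le_of_forall_gt fun b hb => ?_
    obtain ⟨r, htr, hrb⟩ := ENNReal.lt_iff_exists_nnreal_btwn.1 hb
    obtain ⟨q, -, htq, hqr⟩ :=
      (NNReal.lt_iff_exists_rat_btwn _ _).1 (ENNReal.coe_lt_coe.1 htr)
    refine (iInf_le _ q).trans_lt ?_
    rw [if_pos (ht.trans (S.mono j _ _ htq.le))]
    exact (ENNReal.coe_lt_coe.2 hqr).trans hrb

namespace RandomizedAlgorithm

variable {n : ℕ} {α : ℝ}

theorem measurable_totalCompletionTime (B : RandomizedAlgorithm.{u} α n) (J : JobInstance n) :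
    @Measurable _ _ B.mΩ _ fun ω => ((B.alg ω).run J).totalCompletionTime := by
  let _ := B.mΩ
  refine Finset.measurable_sum _ fun j _ => ?_
  simp only [Schedule.completionTime_eq_iInf_rat]
  refine Measurable.iInf fun t => ?_
  exact Measurable.ite (measurableSet_le measurable_const (B.measurable_elapsed J _ j))
    measurable_const measurable_const

/-- The easy direction of Yao's principle: a bound on the average over instances for every
deterministic algorithm survives averaging over the algorithm's randomness. -/
theorem le_sum_mul_expectedCost (B : RandomizedAlgorithm.{u} α n) {ι : Type*} [Fintype ι]
    {w : ι → ℝ≥0∞} {I : ι → JobInstance n} {L : ℝ≥0∞}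
    (h : ∀ A : OnlineAlgorithm α n, L ≤ ∑ f, w f * (A.run (I f)).totalCompletionTime) :
    L ≤ ∑ f, w f * B.expectedCost (I f) := by
  let _ := B.mΩ
  have := B.isProb
  calc L = ∫⁻ _ω, L ∂B.μ := by rw [lintegral_const, measure_univ, mul_one]
    _ ≤ ∫⁻ ω, ∑ f, w f * ((B.alg ω).run (I f)).totalCompletionTime ∂B.μ :=
      lintegral_mono fun ω => h (B.alg ω)
    _ = ∑ f, ∫⁻ ω, w f * ((B.alg ω).run (I f)).totalCompletionTime ∂B.μ :=
      lintegral_finsetSum _ fun f _ => (B.measurable_totalCompletionTime (I f)).const_mul _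
    _ = _ := Finset.sum_congr rfl fun f _ =>
      lintegral_const_mul _ (B.measurable_totalCompletionTime (I f))

theorem opt_le_expectedCost (B : RandomizedAlgorithm.{u} α n) (J : JobInstance n) :
    J.opt ≤ B.expectedCost J := by
  have := B.le_sum_mul_expectedCost (ι := Unit) (w := fun _ => 1) (I := fun _ => J) (L := J.opt)
    fun A => by simpa using J.opt_le (A.run J)
  simpa using this

end RandomizedAlgorithm

theorem OnlineAlgorithm.ofReal_le_sum_weight_mul_cost {n : ℕ} {α q : ℝ} (A : OnlineAlgorithm α n)
    (hα0 : 0 < α) (hα : α ≤ 1) (hq0 : 0 < q) (hq : q < 1) (M : ℕ) :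
    ENNReal.ofReal ((n * (2 * ((1 - q ^ (M + 1)) / (1 - q))) +
      n * (n - 1) * ((1 - α) * ((1 - (q ^ 2) ^ (M + 1)) / (1 - q ^ 2)) +
        α * (2 * ((1 - q ^ (M + 1)) / (1 - q))) - α * (1 / (1 - q)))) / 2) ≤
    ∑ f : Fin n → Fin (M + 1), ENNReal.ofReal (∏ k, geomWeight q M (f k)) *
      (A.run (gridInstance f)).totalCompletionTime := by
  have hpos : ∀ f : Fin n → Fin (M + 1), 0 < ∏ k, geomWeight q M (f k) := fun f =>
    Finset.prod_pos fun k _ => geomWeight_pos hq0 hq M (f k)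
  -- All weights are positive, so a single unfinished run already makes the average infinite.
  by_cases htop : ∃ f : Fin n → Fin (M + 1), (A.run (gridInstance f)).totalCompletionTime = ⊤
  · obtain ⟨f, hf⟩ := htop
    have : ∑ f : Fin n → Fin (M + 1), ENNReal.ofReal (∏ k, geomWeight q M (f k)) *
        (A.run (gridInstance f)).totalCompletionTime = ⊤ := by
      refine ENNReal.sum_eq_top.2 ⟨f, Finset.mem_univ f, ?_⟩
      rw [hf, ENNReal.mul_top (by simpa using hpos f)]
    rw [this]
    exact le_top
  · push Not at htop
    choose C hC using fun f => (A.run (gridInstance f)).exists_forall_completesAt (htop f)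
    have h := A.le_sum_weight_mul_cost hα0 hα hq0 hq hC
    refine (ENNReal.ofReal_le_ofReal h).trans ?_
    rw [ENNReal.ofReal_sum_of_nonneg fun f _ => mul_nonneg (hpos f).le
      (Finset.sum_nonneg fun j _ => (C f j).coe_nonneg)]
    refine Finset.sum_le_sum fun f _ => ?_
    rw [ENNReal.ofReal_mul (hpos f).le, Schedule.totalCompletionTime_eq _ (hC f)]

theorem expectedCost_le_competitiveRatio_mul {α : ℝ} (B : ∀ n : ℕ, RandomizedAlgorithm.{u} α n)
    {n : ℕ} (hn : 0 < n) (J : JobInstance n) :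
    (B n).expectedCost J ≤ competitiveRatio B * ENNReal.ofReal J.sptCost := by
  have hpos : 0 < J.sptCost := lt_of_lt_of_le
    (Finset.sum_pos (fun i _ => J.size_pos i) ⟨⟨0, hn⟩, Finset.mem_univ _⟩)
    J.sum_size_le_sptCost
  rw [← J.opt_eq, ← ENNReal.div_le_iff_le_mul]
  · exact le_iSup₂_of_le n J le_rfl
  · left
    rw [J.opt_eq]
    simpa using hpos
  · left
    rw [J.opt_eq]
    exact ENNReal.ofReal_ne_top

/-- The average of a randomized algorithm over instances with independent sizes that follow a
truncated geometric distribution. -/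
theorem le_competitiveRatio_mul_of_geom {α q r : ℝ} (hα0 : 0 < α) (hα : α ≤ 1) (hq0 : 0 < q)
    (hq : q < 1) (B : ∀ n : ℕ, RandomizedAlgorithm.{u} α n) (hr0 : 0 ≤ r)
    (hr : competitiveRatio B = ENNReal.ofReal r) {n : ℕ} (hn : 0 < n) (M : ℕ) :
    n * (2 * ((1 - q ^ (M + 1)) / (1 - q))) +
      n * (n - 1) * ((1 - α) * ((1 - (q ^ 2) ^ (M + 1)) / (1 - q ^ 2)) +
        α * (2 * ((1 - q ^ (M + 1)) / (1 - q))) - α * (1 / (1 - q))) ≤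
    r * (n * (2 * ((1 - q ^ (M + 1)) / (1 - q))) +
        n * (n - 1) * ((1 - (q ^ 2) ^ (M + 1)) / (1 - q ^ 2))) := by
  have hW : ∀ f : Fin n → Fin (M + 1), 0 ≤ ∏ k, geomWeight q M (f k) := fun f =>
    Finset.prod_nonneg fun k _ => (geomWeight_pos hq0 hq M (f k)).le
  have hspt : ∀ f : Fin n → Fin (M + 1), 0 ≤ (gridInstance f).sptCost := fun f =>
    (Finset.sum_nonneg fun i _ => ((gridInstance f).size_pos i).le).trans
      (gridInstance f).sum_size_le_sptCost
  have h1 := (B n).le_sum_mul_expectedCost fun A =>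
    A.ofReal_le_sum_weight_mul_cost hα0 hα hq0 hq M
  have h2 : ∑ f : Fin n → Fin (M + 1), ENNReal.ofReal (∏ k, geomWeight q M (f k)) *
      (B n).expectedCost (gridInstance f) ≤ ENNReal.ofReal (r * ∑ f : Fin n → Fin (M + 1),
        (∏ k, geomWeight q M (f k)) * (gridInstance f).sptCost) := by
    rw [Finset.mul_sum, ENNReal.ofReal_sum_of_nonneg fun f _ =>
      mul_nonneg hr0 (mul_nonneg (hW f) (hspt f))]
    refine Finset.sum_le_sum fun f _ => ?_
    rw [mul_left_comm, ENNReal.ofReal_mul (hW f), ENNReal.ofReal_mul hr0, ← hr]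
    gcongr
    exact expectedCost_le_competitiveRatio_mul B hn (gridInstance f)
  have h3 := (ENNReal.ofReal_le_ofReal_iff (mul_nonneg hr0 (Finset.sum_nonneg fun f _ =>
    mul_nonneg (hW f) (hspt f)))).1 (h1.trans h2)
  rw [sum_weight_mul_sptCost hq0.le hq] at h3
  linarith

/-- The limit of infinitely many jobs with exponentially distributed sizes. -/
theorem one_add_le_of_geom_bound {α r : ℝ}
    (h : ∀ n : ℕ, 0 < n → ∀ q : ℝ, 0 < q → q < 1 → ∀ M : ℕ,
      n * (2 * ((1 - q ^ (M + 1)) / (1 - q))) +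
        n * (n - 1) * ((1 - α) * ((1 - (q ^ 2) ^ (M + 1)) / (1 - q ^ 2)) +
          α * (2 * ((1 - q ^ (M + 1)) / (1 - q))) - α * (1 / (1 - q))) ≤
      r * (n * (2 * ((1 - q ^ (M + 1)) / (1 - q))) +
          n * (n - 1) * ((1 - (q ^ 2) ^ (M + 1)) / (1 - q ^ 2)))) : 1 + α ≤ r := by
  -- The limit `M → ∞`, multiplied by `1 - q` so that the next limit, `q → 1`, stays finite.
  have h1 : ∀ n : ℕ, 0 < n → ∀ q : ℝ, 0 < q → q < 1 →
      n * 2 + n * (n - 1) * ((1 - α) * (1 / (1 + q)) + α) ≤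
      r * (n * 2 + n * (n - 1) * (1 / (1 + q))) := by
    intro n hn q hq0 hq
    have hp : Filter.Tendsto (fun M : ℕ => q ^ (M + 1)) Filter.atTop (nhds 0) :=
      (tendsto_pow_atTop_nhds_zero_of_lt_one hq0.le hq).comp (Filter.tendsto_add_atTop_nat 1)
    have hp2 : Filter.Tendsto (fun M : ℕ => (q ^ 2) ^ (M + 1)) Filter.atTop (nhds 0) :=
      (tendsto_pow_atTop_nhds_zero_of_lt_one (by positivity) (by nlinarith)).comp
        (Filter.tendsto_add_atTop_nat 1)
    have hm := ((hp.const_sub 1).div_const (1 - q)).const_mul 2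
    have hμ := (hp2.const_sub 1).div_const (1 - q ^ 2)
    have hlim := le_of_tendsto_of_tendsto'
      ((hm.const_mul (n : ℝ)).add ((((hμ.const_mul (1 - α)).add (hm.const_mul α)).sub_const
        (α * (1 / (1 - q)))).const_mul (n * (n - 1) : ℝ)))
      (((hm.const_mul (n : ℝ)).add (hμ.const_mul (n * (n - 1) : ℝ))).const_mul r)
      (h n hn q hq0 hq)
    have h1 : 0 < 1 - q := by linarith
    have h2 : 1 / (1 - q ^ 2) = 1 / (1 + q) * (1 / (1 - q)) := by
      rw [div_mul_div_comm]
      congr 1 <;> ring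
    simp only [sub_zero] at hlim
    rw [h2] at hlim
    have h3 := mul_le_mul_of_nonneg_right hlim h1.le
    have h4 : 1 / (1 - q) * (1 - q) = 1 := by field_simp
    have h5 : ∀ x y : ℝ, (n * (2 * (1 / (1 - q))) + n * (n - 1) *
        (x * (y * (1 / (1 - q))) + α * (2 * (1 / (1 - q))) - α * (1 / (1 - q)))) * (1 - q) =
        (n * 2 + n * (n - 1) * (x * y + α)) * (1 / (1 - q) * (1 - q)) := fun x y => by ring
    have h6 : ∀ y : ℝ, r * (n * (2 * (1 / (1 - q))) + n * (n - 1) * (y * (1 / (1 - q)))) *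
        (1 - q) = r * (n * 2 + n * (n - 1) * y) * (1 / (1 - q) * (1 - q)) := fun y => by ring
    rwa [h5, h6, h4, mul_one, mul_one] at h3
  have h2 : ∀ n : ℕ, 0 < n → (n : ℝ) * 2 + n * (n - 1) * ((1 + α) / 2) ≤
      r * (n * 2 + n * (n - 1) * (1 / 2)) := by
    intro n hn
    have hy : Filter.Tendsto (fun q : ℝ => 1 / (1 + q)) (nhdsWithin 1 (Set.Iio 1))
        (nhds (1 / (1 + 1))) :=
      (ContinuousAt.div continuousAt_const (by fun_prop) (by norm_num)).tendsto.mono_left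
        nhdsWithin_le_nhds
    have hmem : ∀ᶠ q : ℝ in nhdsWithin 1 (Set.Iio 1), 0 < q ∧ q < 1 := by
      filter_upwards [Ioo_mem_nhdsLT (zero_lt_one (α := ℝ))] with q hq using hq
    have := le_of_tendsto_of_tendsto
      ((((hy.const_mul (1 - α)).add_const α).const_mul (n * (n - 1) : ℝ)).const_add (n * 2 : ℝ))
      (((hy.const_mul (n * (n - 1) : ℝ)).const_add (n * 2 : ℝ)).const_mul r)
      (hmem.mono fun q hq => h1 n hn q hq.1 hq.2)
    norm_num at this ⊢
    linarith
  by_contra! hlt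
  -- With `n + 1` jobs the limiting inequality reads `n * (1 + α - r) ≤ 4 * (r - 1)`, which fails
  -- for large `n`.
  obtain ⟨n, hn⟩ := exists_nat_gt (4 * |r - 1| / (1 + α - r))
  have hpos : 0 < 1 + α - r := by linarith
  rw [div_lt_iff₀ hpos] at hn
  have h3 := h2 (n + 1) n.succ_pos
  push_cast at h3
  have h4 : (0 : ℝ) < n + 1 := by positivity
  have h5 : (n + 1 : ℝ) * (2 + n * ((1 + α) / 2)) ≤ (n + 1) * (r * (2 + n * (1 / 2))) := by
    linarith
  have h6 := le_of_mul_le_mul_left h5 h4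
  have h7 := le_abs_self (r - 1)
  linarith

theorem one_add_le_competitiveRatio {α : ℝ} (hα0 : 0 ≤ α) (hα : α ≤ 1)
    (B : ∀ n : ℕ, RandomizedAlgorithm.{u} α n) :
    ENNReal.ofReal (1 + α) ≤ competitiveRatio B := by
  rcases hα0.eq_or_lt with rfl | hpos
  -- For `α = 0` levels cannot be obtained by dividing by `α`, but the claimed ratio is `1`, and a
  -- single job suffices.
  · set J : JobInstance 1 := ⟨fun _ => 1, fun _ => one_pos⟩ with hJ
    have h1 := ((B 1).opt_le_expectedCost J).trans
      (expectedCost_le_competitiveRatio_mul B one_pos J)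
    have h2 : J.sptCost = 1 := by simp [JobInstance.sptCost, hJ]
    rw [J.opt_eq, h2] at h1
    simpa using h1
  · by_cases htop : competitiveRatio B = ⊤
    · rw [htop]
      exact le_top
    · have hr := (ENNReal.ofReal_toReal htop).symm
      rw [hr]
      refine ENNReal.ofReal_le_ofReal (one_add_le_of_geom_bound fun n hn q hq0 hq M => ?_)
      exact le_competitiveRatio_mul_of_geom hpos hα hq0 hq B ENNReal.toReal_nonneg hr hn M

theorem mainTheorem5 (α : ℝ) (hα : α ∈ Set.Icc (0 : ℝ) 1) :
    -- for `0 < α` the rule is an online algorithm, and its competitive ratio is `1 + α`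
    (0 < α →
      (∃ A : ∀ n : ℕ, OnlineAlgorithm α n,
        ∀ (n : ℕ) (J : JobInstance n), ((A n).run J).IsSignalRoundRobin α) ∧
      (∀ A : ∀ n : ℕ, OnlineAlgorithm α n,
        (∀ (n : ℕ) (J : JobInstance n), ((A n).run J).IsSignalRoundRobin α) →
        competitiveRatio (fun n => (A n).toRandomized) = ENNReal.ofReal (1 + α))) ∧
    -- for `α = 0` (all signals at time `0`) the rule is optimal if it serves short jobs first
    (α = 0 → ∀ (n : ℕ) (J : JobInstance n),
      (∃ S : Schedule J, S.IsSignalRoundRobin α ∧ S.ShortestFirst) ∧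
      (∀ S : Schedule J, S.IsSignalRoundRobin α → S.ShortestFirst →
        S.totalCompletionTime = J.opt)) ∧
    -- no randomized online algorithm has a smaller competitive ratio
    (∀ B : ∀ n : ℕ, RandomizedAlgorithm.{u} α n,
      ENNReal.ofReal (1 + α) ≤ competitiveRatio B) := by
  refine ⟨fun hpos => ⟨?_, fun A hA => ?_⟩, ?_, one_add_le_competitiveRatio hα.1 hα.2⟩
  · choose A hA using exists_onlineAlgorithm_isSignalRoundRobin hpos hα.2
    exact ⟨A, hA⟩
  · exact (OnlineAlgorithm.competitiveRatio_le hpos hα.2 A hA).antisymm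
      (one_add_le_competitiveRatio hα.1 hα.2 _)
  · rintro rfl n J
    refine ⟨Schedule.exists_isSignalRoundRobin_shortestFirst J, fun S hS hsf =>
      le_antisymm ?_ (J.opt_le S)⟩
    have := hS.totalCompletionTime_le le_rfl zero_le_one (Or.inr hsf)
    rwa [add_zero, one_mul, ← J.opt_eq] at this
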